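/- Let $k$ be a field of characteristic zero. All group schemes are affine group schemes over $k$; "algebraic" means of finite type, and a proalgebraic group is an arbitrary affine group scheme, i.e. an inverse limit of algebraic groups. Let $R$ be an algebraic group and $w:\mathbb{G}_m\to R$ a homomorphism with image in the centre of $R$. For an extension $1\to U\to G\to R\to 1$ of algebraic groups with $U$ unipotent, $H_1(U)$ (the vector group $U^{\mathrm{ab}}$, i.e. the dual of $H^1(U,k)=\mathrm{Hom}(U,\mathbb{G}_a)$) is an $R$-module by conjugation, hence a $\mathbb{G}_m$-module via $w$; the extension is negatively weighted if the weight $m$ part of $H_1(U)$ vanishes for all $m\ge 0$. A proalgebraic group $\mathcal{G}\to R$ is a negatively weighted extension of $R$ if it is the inverse limit of a directed system of negatively weighted algebraic extensions $G_\alpha\to R$, with surjections $\mathcal{G}\to G_\alpha$ over $R$. A weighted module is a tuple $(V,R,w,\mathcal{G})$ where $\mathcal{G}$ is a negatively weighted extension of $R$ with respect to $w$ and $V$ is a finite-dimensional $\mathcal{G}$-module. A morphism $(V_1,R_1,w_1,\mathcal{G}_1)\to(V_2,R_2,w_2,\mathcal{G}_2)$ consists of homomorphisms $\Phi:\mathcal{G}_1\to\mathcal{G}_2$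 and $\phi:R_1\to R_2$, compatible with the projections $\mathcal{G}_i\to R_i$ and with $\phi\circ w_1=w_2$, and a $\mathcal{G}_1$-equivariant linear map $f:V_1\to V_2$, where $V_2$ is a $\mathcal{G}_1$-module via $\Phi$. Theorem. Every weighted module $V$ has a unique increasing filtration $W_\bullet V$ indexed by $\mathbb{Z}$ (the weight filtration), with $W_aV=0$ for some $a$ and $W_bV=V$ for some $b$, by $\mathcal{G}$-submodules, such that for every $m$, with $\mathrm{Gr}^W_mV=W_mV/W_{m-1}V$, the action of $\mathcal{G}$ on $\mathrm{Gr}^W_mV$ factors through $\mathcal{G}\to R$ and $\mathbb{G}_m$ acts on $\mathrm{Gr}^W_mV$ via $w$ by the $m$-th power of the standard character. Moreover: 1. If the action on $V$ factors through a quotient $\mathcal{G}\to G'$ over $R$ and $\tilde w:\mathbb{G}_m\to G'$ is any lift of $w$, then $W_nV=\bigoplus_{m\le n}V_m$, where $V_m$ is the weight $m$ subspace of $V$ under $\tilde w$. 2. For finite-dimensional $\mathcal{G}$-modules $V_1,V_2$ one has $W_n(V_1\otimes V_2)=\sum_{r+s=n}W_rV_1\otimes W_sV_2$ and $W_n\mathrm{Hom}(V_1,V_2)=\{\varphi:\varphi(W_rV_1)\subseteq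 W_{r+n}V_2\text{ for all }r\in\mathbb{Z}\}$. 3. For every morphism of weighted modules, the linear map $f:V_1\to V_2$ preserves the weight filtration and is strict: $\mathrm{im} f\cap W_mV_2=f(W_mV_1)$ for all $m\in\mathbb{Z}$. 4. For every $m$, the functors $V\mapsto \mathrm{Gr}^W_mV$, $V\mapsto W_mV$ and $V\mapsto V/W_mV$ are exact: they send every sequence of morphisms of weighted modules whose underlying sequence $0\to V_1\to V_2\to V_3\to 0$ of vector spaces is exact to a short exact sequence. In particular, they are exact on the category of finite-dimensional $\mathcal{G}$-modules. -/

import Mathlib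

open scoped TensorProduct LaurentPolynomial
open CategoryTheory

universe u r g v

noncomputable section

namespace NegWt

open Coalgebra HopfAlgebra

/-! An affine group scheme `G` over a field `k` is given by its coordinate ring, a commutative Hopf
algebra `A = O(G)` over `k`; `G` is algebraic when `A` is of finite type, and an arbitrary affine
group scheme is the same thing as a proalgebraic group. A homomorphism `G → H` is a bialgebra
homomorphism `O(H) → O(G)`. The multiplicative group has coordinate ring `k[T;T⁻¹]`, in which
`T` is group-like. -/

/-! ### Modules over an affine group scheme -/

section Comodules

variable {k : Type u} [Field k] {A B : Type*} [CommRing A] [HopfAlgebra k A]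
  [CommRing B] [HopfAlgebra k B]

/-- A `G`-module structure on the vector space `V`, where `A = O(G)`: a coaction
`V → V ⊗ A`. A point `x : A → S` of `G` acts on `V ⊗ S` by `v ↦ (id ⊗ x) (coact v)`. -/
@[ext]
structure GModule (k : Type u) [Field k] (A : Type*) [CommRing A] [HopfAlgebra k A]
    (V : Type*) [AddCommGroup V] [Module k V] where
  coact : V →ₗ[k] V ⊗[k] A
  coassoc : ∀ v, TensorProduct.assoc k V A A (coact.rTensor A (coact v)) =
    (comul (R := k) (A := A)).lTensor V (coact v)
  counit_coact : ∀ v, (counit (R := k) (A := A)).lTensor V (coact v) = v ⊗ₜ[k] (1 : k)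

variable {V V₁ V₂ V₃ : Type*} [AddCommGroup V] [Module k V] [AddCommGroup V₁] [Module k V₁]
  [AddCommGroup V₂] [Module k V₂] [AddCommGroup V₃] [Module k V₃]

/-- `G`-equivariant linear maps. -/
def IsGHom (ρ : GModule k A V₁) (σ : GModule k A V₂) (f : V₁ →ₗ[k] V₂) : Prop :=
  ∀ v, σ.coact (f v) = f.rTensor A (ρ.coact v)

/-- The module obtained by restricting along the homomorphism of group schemes with
comorphism `φ`. -/
def GModule.res (ρ : GModule k A V) (φ : A →ₐc[k] B) : GModule k B V where
  coact := (φ : A →ₗ[k] B).lTensor V ∘ₗ ρ.coact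
  coassoc v := by
    have h1 : ∀ x : V ⊗[k] A,
        TensorProduct.assoc k V B B ((((φ : A →ₗ[k] B).lTensor V) ∘ₗ ρ.coact).rTensor B
          ((φ : A →ₗ[k] B).lTensor V x)) =
        (TensorProduct.map (φ : A →ₗ[k] B) (φ : A →ₗ[k] B)).lTensor V
          (TensorProduct.assoc k V A A (ρ.coact.rTensor A x)) := by
      intro x
      induction x with
      | zero => simp
      | add x y hx hy => simp only [map_add, hx, hy]
      | tmul w a =>
        simp only [LinearMap.lTensor_tmul, LinearMap.rTensor_tmul, LinearMap.comp_apply]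
        induction ρ.coact w with
        | zero => simp
        | add x y hx hy => simp only [map_add, TensorProduct.add_tmul, hx, hy]
        | tmul w' a' => simp
    have h2 : ∀ x : V ⊗[k] A, (comul (R := k) (A := B)).lTensor V
        ((φ : A →ₗ[k] B).lTensor V x) =
        (TensorProduct.map (φ : A →ₗ[k] B) (φ : A →ₗ[k] B)).lTensor V
          ((comul (R := k) (A := A)).lTensor V x) := by
      intro x
      induction x with
      | zero => simp
      | add x y hx hy => simp only [map_add, hx, hy]
      | tmul w a =>
        simp only [LinearMap.lTensor_tmul]
        congr 1
        exact (CoalgHomClass.map_comp_comul_apply φ a).symm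
    simp only [LinearMap.comp_apply] at h1 ⊢
    rw [h1, h2, ρ.coassoc]
  counit_coact v := by
    rw [← ρ.counit_coact v]
    simp only [LinearMap.comp_apply]
    induction ρ.coact v with
    | zero => simp
    | add x y hx hy => simp only [map_add, hx, hy]
    | tmul w a => simp

/-- For a `G`-module `V` and a homomorphism `𝔾ₘ → G` with comorphism `χ`, the subspace on which
`𝔾ₘ` acts by the `m`-th power of the standard character. -/
def GModule.weightSpace (ρ : GModule k A V) (χ : A →ₐc[k] k[T;T⁻¹]) (m : ℤ) : Submodule k V :=
  LinearMap.eqLocus (ρ.res χ).coact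
    ((TensorProduct.mk k V k[T;T⁻¹]).flip (LaurentPolynomial.T m))

end Comodules

/-! ### Tensor products and internal Homs of modules -/

section TensorHom

variable {k : Type u} [Field k]
variable {V V₁ V₂ : Type*} [AddCommGroup V] [Module k V] [AddCommGroup V₁] [Module k V₁]
  [AddCommGroup V₂] [Module k V₂]

/-- `(v ⊗ a, w ⊗ b) ↦ (v ⊗ w) ⊗ ab`. -/
def mulTensor (k : Type u) [Field k] (V₁ V₂ : Type*) [AddCommGroup V₁] [Module k V₁]
    [AddCommGroup V₂] [Module k V₂] (C : Type*) [CommRing C] [Algebra k C] :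
    (V₁ ⊗[k] C) ⊗[k] (V₂ ⊗[k] C) →ₗ[k] (V₁ ⊗[k] V₂) ⊗[k] C :=
  (LinearMap.mul' k C).lTensor (V₁ ⊗[k] V₂) ∘ₗ
    (TensorProduct.tensorTensorTensorComm k V₁ C V₂ C).toLinearMap

@[simp]
lemma mulTensor_tmul {C : Type*} [CommRing C] [Algebra k C] (v : V₁) (w : V₂) (a b : C) :
    mulTensor k V₁ V₂ C ((v ⊗ₜ a) ⊗ₜ (w ⊗ₜ b)) = (v ⊗ₜ w) ⊗ₜ (a * b) := by
  simp [mulTensor]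

lemma mulTensor_natural {C D : Type*} [CommRing C] [Algebra k C] [CommRing D] [Algebra k D]
    (f : C →ₐ[k] D) (x : V₁ ⊗[k] C) (y : V₂ ⊗[k] C) :
    f.toLinearMap.lTensor _ (mulTensor k V₁ V₂ C (x ⊗ₜ y)) =
      mulTensor k V₁ V₂ D (f.toLinearMap.lTensor _ x ⊗ₜ f.toLinearMap.lTensor _ y) := by
  induction x with
  | zero => simp
  | add x x' hx hx' => simp only [map_add, TensorProduct.add_tmul, hx, hx']
  | tmul v a =>
    induction y with
    | zero => simp
    | add y y' hy hy' => simp only [map_add, TensorProduct.tmul_add, hy, hy']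
    | tmul w b => simp

variable {A : Type*} [CommRing A] [HopfAlgebra k A]

/-- The tensor product of two `G`-modules, with the diagonal action. -/
def GModule.tensor (ρ : GModule k A V₁) (σ : GModule k A V₂) : GModule k A (V₁ ⊗[k] V₂) where
  coact := mulTensor k V₁ V₂ A ∘ₗ TensorProduct.map ρ.coact σ.coact
  coassoc z := by
    have key : ∀ (x : V₁ ⊗[k] A) (y : V₂ ⊗[k] A),
        TensorProduct.assoc k (V₁ ⊗[k] V₂) A A
          ((mulTensor k V₁ V₂ A ∘ₗ TensorProduct.map ρ.coact σ.coact).rTensor A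
            (mulTensor k V₁ V₂ A (x ⊗ₜ y))) =
        mulTensor k V₁ V₂ (A ⊗[k] A)
          (TensorProduct.assoc k V₁ A A (ρ.coact.rTensor A x) ⊗ₜ
            TensorProduct.assoc k V₂ A A (σ.coact.rTensor A y)) := by
      intro x y
      induction x with
      | zero => simp
      | add x x' hx hx' => simp only [map_add, TensorProduct.add_tmul, hx, hx']
      | tmul v a =>
        induction y with
        | zero => simp
        | add y y' hy hy' => simp only [map_add, TensorProduct.tmul_add, hy, hy']
        | tmul w b =>
          simp only [mulTensor_tmul, LinearMap.rTensor_tmul, LinearMap.comp_apply,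
            TensorProduct.map_tmul]
          induction ρ.coact v with
          | zero => simp
          | add x x' hx hx' => simp only [map_add, TensorProduct.add_tmul, hx, hx']
          | tmul v' a' =>
            induction σ.coact w with
            | zero => simp
            | add y y' hy hy' =>
              simp only [map_add, TensorProduct.tmul_add, TensorProduct.add_tmul, hy, hy']
            | tmul w' b' => simp
    induction z with
    | zero => simp
    | add x y hx hy => simp only [map_add, hx, hy]
    | tmul v w =>
      have := mulTensor_natural (V₁ := V₁) (V₂ := V₂) (Bialgebra.comulAlgHom k A)
        (ρ.coact v) (σ.coact w)
      simp only [LinearMap.comp_apply, TensorProduct.map_tmul] at key ⊢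
      rw [key, ρ.coassoc, σ.coassoc]
      exact this.symm
  counit_coact z := by
    induction z with
    | zero => simp
    | add x y hx hy => simp only [map_add, hx, hy, TensorProduct.add_tmul]
    | tmul v w =>
      have h := mulTensor_natural (V₁ := V₁) (V₂ := V₂) (Bialgebra.counitAlgHom k A)
        (ρ.coact v) (σ.coact w)
      have hρ := ρ.counit_coact v
      have hσ := σ.counit_coact w
      simp only [LinearMap.comp_apply, TensorProduct.map_tmul]
      refine h.trans ?_
      change mulTensor k V₁ V₂ k ((counit (R := k) (A := A)).lTensor V₁ (ρ.coact v) ⊗ₜ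
        (counit (R := k) (A := A)).lTensor V₂ (σ.coact w)) = _
      rw [hρ, hσ]
      simp

/-- `(v ⊗ a, b) ↦ v ⊗ ab`. -/
def mulRight (k : Type u) [Field k] (V : Type*) [AddCommGroup V] [Module k V]
    (C : Type*) [CommRing C] [Algebra k C] : (V ⊗[k] C) ⊗[k] C →ₗ[k] V ⊗[k] C :=
  (LinearMap.mul' k C).lTensor V ∘ₗ (TensorProduct.assoc k V C C).toLinearMap

@[simp]
lemma mulRight_tmul {C : Type*} [CommRing C] [Algebra k C] (v : V) (a b : C) :
    mulRight k V C ((v ⊗ₜ a) ⊗ₜ b) = v ⊗ₜ (a * b) := by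
  simp [mulRight]

lemma mulRight_natural {C D : Type*} [CommRing C] [Algebra k C] [CommRing D] [Algebra k D]
    (f : C →ₐ[k] D) (x : V ⊗[k] C) (b : C) :
    f.toLinearMap.lTensor _ (mulRight k V C (x ⊗ₜ b)) =
      mulRight k V D (f.toLinearMap.lTensor _ x ⊗ₜ f b) := by
  induction x with
  | zero => simp
  | add x x' hx hx' => simp only [map_add, TensorProduct.add_tmul, hx, hx']
  | tmul v a => simp

/-- For a linear map `φ : V₁ → V₂` between `G`-modules, the map `V₁ → V₂ ⊗ A` that describes
`x ↦ x ∘ φ ∘ x⁻¹` for points `x` of `G`: it sends `v` to `φ(v₀)₀ ⊗ φ(v₀)₁ S(v₁)`. -/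
def conjMap (ρ : GModule k A V₁) (σ : GModule k A V₂) :
    (V₁ →ₗ[k] V₂) →ₗ[k] (V₁ →ₗ[k] V₂ ⊗[k] A) where
  toFun φ := mulRight k V₂ A ∘ₗ TensorProduct.map (σ.coact ∘ₗ φ) (antipode k (A := A)) ∘ₗ ρ.coact
  map_add' φ ψ := by
    simp only [LinearMap.comp_add, TensorProduct.map_add_left, LinearMap.add_comp]
  map_smul' c φ := by
    simp only [LinearMap.comp_smul, TensorProduct.map_smul_left, LinearMap.smul_comp,
      RingHom.id_apply]

lemma comul_antipode (a : A) :
    comul (R := k) (antipode k a) =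
      TensorProduct.map (antipode k (A := A)) (antipode k (A := A))
        (TensorProduct.comm k A A (comul (R := k) a)) := by
  let i₁ : WithConv (A →ₐ[k] A ⊗[k] A) := .toConv Algebra.TensorProduct.includeLeft
  let i₂ : WithConv (A →ₐ[k] A ⊗[k] A) := .toConv Algebra.TensorProduct.includeRight
  let d : WithConv (A →ₐ[k] A ⊗[k] A) := .toConv (Bialgebra.comulAlgHom k A)
  have h1 : d = i₁ * i₂ := by
    apply WithConv.ofConv_injective
    ext a
    change comul (R := k) a = (i₁ * i₂) a
    rw [AlgHom.convMul_apply]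
    induction comul (R := k) a with
    | zero => simp
    | add x y hx hy => rw [map_add, ← hx, ← hy]
    | tmul x y => simp [i₁, i₂]
  have h2 : d⁻¹ = i₂⁻¹ * i₁⁻¹ := by
    rw [h1]
    exact mul_inv_rev (G := WithConv (A →ₐ[k] A ⊗[k] A)) i₁ i₂
  have h3 : d⁻¹ a = (i₂⁻¹ * i₁⁻¹) a := by rw [h2]
  have h4 : d⁻¹ a = comul (R := k) (antipode k a) := rfl
  rw [← h4, h3, AlgHom.convMul_apply]
  have e1 : ∀ x, i₁⁻¹.ofConv x = antipode k x ⊗ₜ[k] (1 : A) := fun x => rfl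
  have e2 : ∀ x, i₂⁻¹.ofConv x = (1 : A) ⊗ₜ[k] antipode k x := fun x => rfl
  induction comul (R := k) a with
  | zero => simp
  | add x y hx hy => simp only [map_add, hx, hy]
  | tmul x y => simp [e1, e2]

lemma homRTensor_lTensor {C D : Type*} [CommRing C] [Algebra k C] [CommRing D] [Algebra k D]
    (f : C →ₗ[k] D) (z : (V₁ →ₗ[k] V₂) ⊗[k] C) (u : V₁) :
    TensorProduct.rTensorHomToHomRTensor (.id k) V₁ V₂ D (f.lTensor _ z) u =
      f.lTensor _ (TensorProduct.rTensorHomToHomRTensor (.id k) V₁ V₂ C z u) := by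
  induction z with
  | zero => simp
  | add x y hx hy => simp only [map_add, LinearMap.add_apply, hx, hy]
  | tmul φ c => simp

/-- The `G`-module `Hom(V₁, V₂)`, for `V₁` finite dimensional, with the action
`x • φ = x ∘ φ ∘ x⁻¹`. -/
def GModule.hom [Module.Finite k V₁] (ρ : GModule k A V₁) (σ : GModule k A V₂) :
    GModule k A (V₁ →ₗ[k] V₂) where
  coact := (rTensorHomEquivHomRTensor k V₁ V₂ A).symm.toLinearMap ∘ₗ conjMap ρ σ
  coassoc φ := by
    apply (rTensorHomEquivHomRTensor k V₁ V₂ (A ⊗[k] A)).injective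
    ext u
    rw [rTensorHomEquivHomRTensor_apply, rTensorHomEquivHomRTensor_apply, homRTensor_lTensor]
    have hE : ∀ ψ, TensorProduct.rTensorHomToHomRTensor (.id k) V₁ V₂ A
        ((rTensorHomEquivHomRTensor k V₁ V₂ A).symm (conjMap ρ σ ψ)) = conjMap ρ σ ψ := by
      intro ψ
      rw [← rTensorHomEquivHomRTensor_apply, LinearEquiv.apply_symm_apply]
    rw [LinearMap.comp_apply, LinearEquiv.coe_coe, hE]
    let S := antipode k (A := A)
    let N : (V₂ ⊗[k] A) ⊗[k] A →ₗ[k] V₂ ⊗[k] (A ⊗[k] A) :=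
      mulRight k V₂ (A ⊗[k] A) ∘ₗ
        TensorProduct.map ((TensorProduct.assoc k V₂ A A).toLinearMap ∘ₗ σ.coact.rTensor A)
          ((TensorProduct.mk k A A).flip 1)
    let Q : V₁ ⊗[k] (A ⊗[k] A) →ₗ[k] V₂ ⊗[k] (A ⊗[k] A) :=
      mulRight k V₂ (A ⊗[k] A) ∘ₗ
        TensorProduct.map ((comul (R := k) (A := A)).lTensor V₂ ∘ₗ σ.coact ∘ₗ φ)
          (TensorProduct.map S S ∘ₗ (TensorProduct.comm k A A).toLinearMap)
    have assocE : ∀ (z : (V₁ →ₗ[k] V₂) ⊗[k] A) (a : A),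
        TensorProduct.rTensorHomToHomRTensor (.id k) V₁ V₂ (A ⊗[k] A)
          (TensorProduct.assoc k _ A A (z ⊗ₜ a)) u =
        TensorProduct.assoc k V₂ A A
          (TensorProduct.rTensorHomToHomRTensor (.id k) V₁ V₂ A z u ⊗ₜ a) := by
      intro z a
      induction z with
      | zero => simp
      | add x y hx hy => simp only [map_add, TensorProduct.add_tmul, LinearMap.add_apply, hx, hy]
      | tmul χ b => simp
    have step1 : ∀ z : (V₁ →ₗ[k] V₂) ⊗[k] A,
        TensorProduct.rTensorHomToHomRTensor (.id k) V₁ V₂ (A ⊗[k] A)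
          (TensorProduct.assoc k _ A A
            (((rTensorHomEquivHomRTensor k V₁ V₂ A).symm.toLinearMap ∘ₗ
              conjMap ρ σ).rTensor A z)) u =
        N (TensorProduct.map (TensorProduct.rTensorHomToHomRTensor (.id k) V₁ V₂ A z) S
          (ρ.coact u)) := by
      intro z
      induction z with
      | zero => simp
      | add x y hx hy =>
        simp only [map_add, LinearMap.add_apply, TensorProduct.map_add_left, hx, hy]
      | tmul χ a =>
        rw [LinearMap.rTensor_tmul, assocE, LinearMap.comp_apply, LinearEquiv.coe_coe, hE]
        simp only [conjMap, LinearMap.coe_mk, AddHom.coe_mk, LinearMap.comp_apply]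
        induction ρ.coact u with
        | zero => simp
        | add x y hx hy => simp only [map_add, TensorProduct.add_tmul, hx, hy]
        | tmul w b =>
          simp only [TensorProduct.map_tmul, LinearMap.comp_apply,
            TensorProduct.rTensorHomToHomRTensor_apply, N, LinearMap.rTensor_tmul]
          induction σ.coact (χ w) with
          | zero => simp
          | add x y hx hy => simp only [map_add, TensorProduct.add_tmul, hx, hy]
          | tmul v c => simp [S]
    have step2 : ∀ x : V₁ ⊗[k] A, N (TensorProduct.map (conjMap ρ σ φ) S x) =
        Q (TensorProduct.assoc k V₁ A A (ρ.coact.rTensor A x)) := by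
      intro x
      induction x with
      | zero => simp
      | add x y hx hy => simp only [map_add, hx, hy]
      | tmul w b =>
        simp only [conjMap, TensorProduct.map_tmul, LinearMap.coe_mk, AddHom.coe_mk,
          LinearMap.comp_apply, LinearMap.rTensor_tmul]
        induction ρ.coact w with
        | zero => simp
        | add x y hx hy => simp only [map_add, TensorProduct.add_tmul, hx, hy]
        | tmul w' a =>
          have h1 : ∀ (y : V₂ ⊗[k] A) (s : A),
              TensorProduct.assoc k V₂ A A (σ.coact.rTensor A (mulRight k V₂ A (y ⊗ₜ s))) =
              mulRight k V₂ (A ⊗[k] A)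
                (TensorProduct.assoc k V₂ A A (σ.coact.rTensor A y) ⊗ₜ ((1 : A) ⊗ₜ s)) := by
            intro y s
            induction y with
            | zero => simp
            | add x y hx hy => simp only [map_add, TensorProduct.add_tmul, hx, hy]
            | tmul v c =>
              simp only [mulRight_tmul, LinearMap.rTensor_tmul]
              induction σ.coact v with
              | zero => simp
              | add x y hx hy => simp only [map_add, TensorProduct.add_tmul, hx, hy]
              | tmul v' c' => simp
          have h2 : ∀ (X : V₂ ⊗[k] (A ⊗[k] A)) (s t : A),
              mulRight k V₂ (A ⊗[k] A)
                (mulRight k V₂ (A ⊗[k] A) (X ⊗ₜ ((1 : A) ⊗ₜ s)) ⊗ₜ (t ⊗ₜ (1 : A))) =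
              mulRight k V₂ (A ⊗[k] A) (X ⊗ₜ (t ⊗ₜ s)) := by
            intro X s t
            induction X with
            | zero => simp
            | add x y hx hy => simp only [map_add, TensorProduct.add_tmul, hx, hy]
            | tmul v c => simp [mul_assoc]
          simp only [N, Q, TensorProduct.map_tmul, LinearMap.comp_apply, LinearEquiv.coe_coe,
            TensorProduct.assoc_tmul, LinearMap.flip_apply, TensorProduct.mk_apply,
            TensorProduct.comm_tmul]
          rw [h1, h2, σ.coassoc]
    have step3 : ∀ x : V₁ ⊗[k] A, Q ((comul (R := k) (A := A)).lTensor V₁ x) =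
        (comul (R := k) (A := A)).lTensor V₂
          (mulRight k V₂ A (TensorProduct.map (σ.coact ∘ₗ φ) S x)) := by
      intro x
      induction x with
      | zero => simp
      | add x y hx hy => simp only [map_add, hx, hy]
      | tmul w a =>
        simp only [Q, LinearMap.lTensor_tmul, LinearMap.comp_apply, TensorProduct.map_tmul,
          LinearEquiv.coe_coe]
        refine Eq.trans ?_
          (mulRight_natural (Bialgebra.comulAlgHom k A) (σ.coact (φ w)) (S a)).symm
        congr 2
        exact (comul_antipode a).symm
    rw [step1, hE, step2, ρ.coassoc, step3]
    rfl
  counit_coact φ := by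
    apply (rTensorHomEquivHomRTensor k V₁ V₂ k).injective
    ext u
    rw [rTensorHomEquivHomRTensor_apply, rTensorHomEquivHomRTensor_apply, homRTensor_lTensor,
      ← rTensorHomEquivHomRTensor_apply, LinearMap.comp_apply, LinearEquiv.coe_coe,
      LinearEquiv.apply_symm_apply]
    have h : ∀ x : V₁ ⊗[k] A, (counit (R := k) (A := A)).lTensor V₂
        (mulRight k V₂ A (TensorProduct.map (σ.coact ∘ₗ φ) (antipode k (A := A)) x)) =
        φ.rTensor k ((counit (R := k) (A := A)).lTensor V₁ x) := by
      intro x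
      induction x with
      | zero => simp
      | add x y hx hy => simp only [map_add, hx, hy]
      | tmul w a =>
        simp only [LinearMap.lTensor_tmul, LinearMap.comp_apply, TensorProduct.map_tmul,
          LinearMap.rTensor_tmul]
        refine (mulRight_natural (Bialgebra.counitAlgHom k A) (σ.coact (φ w))
          (antipode k a)).trans ?_
        change mulRight k V₂ k ((counit (R := k) (A := A)).lTensor V₂ (σ.coact (φ w)) ⊗ₜ
          counit (R := k) (antipode k a)) = _
        rw [σ.counit_coact]
        simp
    refine (h _).trans ?_
    rw [ρ.counit_coact]
    simp

end TensorHom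

/-! ### Kernels, unipotent groups and negatively weighted extensions -/

section Extensions

variable {k : Type u} [Field k] {O B : Type*} [CommRing O] [HopfAlgebra k O]
  [CommRing B] [HopfAlgebra k B]

/-- The ideal of `O(G)` that defines the kernel of the homomorphism `G → R` with comorphism `q`:
it is generated by the image of the augmentation ideal of `O(R)`. -/
def kernelIdeal (q : O →ₐc[k] B) : Ideal B :=
  (RingHom.ker (Bialgebra.counitAlgHom k O)).map (q : O →ₐ[k] B)

lemma antipode_bialgHom (q : O →ₐc[k] B) (x : O) : antipode k (q x) = q (antipode k x) := by
  let c : WithConv (O →ₐ[k] B) := .toConv (q : O →ₐ[k] B)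
  have h1 : c⁻¹ = .toConv ((q : O →ₐ[k] B).comp (antipodeAlgHom k O)) := rfl
  have h2 : WithConv.toConv ((antipodeAlgHom k B).comp (q : O →ₐ[k] B)) * c = 1 := by
    apply WithConv.ofConv_injective
    refine (AlgHom.convMul_comp_bialgHom_distrib (.toConv (antipodeAlgHom k B))
      (.toConv (AlgHom.id k B)) q).symm.trans ?_
    rw [AlgHom.antipode_id_cancel]
    ext y
    change algebraMap k B (counit (R := k) (q y)) = algebraMap k B (counit (R := k) y)
    rw [CoalgHomClass.counit_comp_apply]
  have h3 := eq_inv_of_mul_eq_one_left h2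
  rw [h1] at h3
  exact congrArg (fun f : WithConv (O →ₐ[k] B) => f x) h3

lemma mk_kernelIdeal (q : O →ₐc[k] B) (x : O) :
    Ideal.Quotient.mk (kernelIdeal q) (q x) =
      algebraMap k (B ⧸ kernelIdeal q) (counit (R := k) x) := by
  have h : q (x - algebraMap k O (counit (R := k) x)) ∈ kernelIdeal q := by
    apply Ideal.mem_map_of_mem (q : O →ₐ[k] B)
    simp [RingHom.mem_ker]
  have h2 : q (algebraMap k O (counit (R := k) x)) = algebraMap k B (counit (R := k) x) :=
    AlgHomClass.commutes q _
  rw [map_sub, h2] at h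
  exact (Ideal.Quotient.eq.mpr h)

instance (q : O →ₐc[k] B) : (kernelIdeal q).IsHopfIdeal k where
  counit_eq_zero := by
    have : kernelIdeal q ≤ RingHom.ker (Bialgebra.counitAlgHom k B) := by
      refine Ideal.map_le_iff_le_comap.mpr ?_
      intro x hx
      simpa [RingHom.mem_ker] using hx
    intro x hx
    exact this hx
  map_mkQ_comul_eq_zero := by
    let π := Ideal.Quotient.mkₐ k (kernelIdeal q)
    have : kernelIdeal q ≤ RingHom.ker ((Algebra.TensorProduct.map π π).comp
        (Bialgebra.comulAlgHom k B)) := by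
      refine Ideal.map_le_iff_le_comap.mpr ?_
      intro x hx
      have hx' : counit (R := k) x = 0 := hx
      change TensorProduct.map π.toLinearMap π.toLinearMap (comul (R := k) (q x)) = 0
      rw [← CoalgHomClass.map_comp_comul_apply q x]
      have h : ∀ z : O ⊗[k] O, TensorProduct.map π.toLinearMap π.toLinearMap
          (TensorProduct.map (q : O →ₗ[k] B) (q : O →ₗ[k] B) z) =
          TensorProduct.map (Algebra.linearMap k (B ⧸ kernelIdeal q))
            (Algebra.linearMap k (B ⧸ kernelIdeal q))
            ((counit (R := k) (A := O)).rTensor k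
              ((counit (R := k) (A := O)).lTensor O z)) := by
        intro z
        induction z with
        | zero => simp
        | add x y hx hy => simp only [map_add, hx, hy]
        | tmul a b =>
          simp only [TensorProduct.map_tmul, LinearMap.lTensor_tmul, LinearMap.rTensor_tmul]
          exact congrArg₂ (· ⊗ₜ[k] ·) (mk_kernelIdeal q a) (mk_kernelIdeal q b)
      refine (h _).trans ?_
      rw [Coalgebra.lTensor_counit_comul]
      simp [hx']
    intro x hx
    exact this hx
  antipode_mem := by
    have : kernelIdeal q ≤ (kernelIdeal q).comap (antipodeAlgHom k B) := by
      refine Ideal.map_le_iff_le_comap.mpr ?_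
      intro x hx
      have hx' : counit (R := k) x = 0 := hx
      change antipode k (q x) ∈ kernelIdeal q
      rw [antipode_bialgHom]
      apply Ideal.mem_map_of_mem (q : O →ₐ[k] B)
      simp [RingHom.mem_ker, hx']
    intro x hx
    exact this hx

/-- The coordinate ring of the kernel of the homomorphism with comorphism `q`. -/
abbrev KernelRing (q : O →ₐc[k] B) : Type _ := B ⧸ kernelIdeal q

/-- An affine group scheme `U` is unipotent if every nonzero finite dimensional `U`-module contains
a nonzero fixed vector. -/
def IsUnipotent (k : Type u) [Field k] (C : Type*) [CommRing C] [HopfAlgebra k C] : Prop :=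
  ∀ (n : ℕ) (ρ : GModule k C (Fin (n + 1) → k)),
    ∃ x : Fin (n + 1) → k, x ≠ 0 ∧ ρ.coact x = x ⊗ₜ[k] (1 : C)

/-- `Hom(U, 𝔾ₐ) = H¹(U, k)`: the primitive elements of `C = O(U)`. -/
def homGa (k : Type u) [Field k] (C : Type*) [CommRing C] [HopfAlgebra k C] : Submodule k C :=
  LinearMap.eqLocus (comul (R := k) (A := C))
    ((TensorProduct.mk k C C).flip 1 + TensorProduct.mk k C C 1)

/-- The first homology `H₁(U)`, the dual of `H¹(U, k) = Hom(U, 𝔾ₐ)`. In characteristic zero, the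
abelianization of a unipotent algebraic group `U` is a vector group, and `H₁(U)` is this vector
group, that is, `𝔲 / [𝔲, 𝔲]` for the Lie algebra `𝔲` of `U`. -/
abbrev H₁ (k : Type u) [Field k] (C : Type*) [CommRing C] [HopfAlgebra k C] : Type _ :=
  Module.Dual k (homGa k C)

/-- The conjugation action of `G` on functions on `G`, `(g • b)(h) = b(g⁻¹ h g)`, as the map
`b ↦ b₂ ⊗ S(b₁) b₃`. -/
def conjCoact (k : Type u) [Field k] (B : Type*) [CommRing B] [HopfAlgebra k B] :
    B →ₗ[k] B ⊗[k] B :=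
  (LinearMap.mul' k B ∘ₗ (antipode k (A := B)).rTensor B).lTensor B ∘ₗ
    (TensorProduct.leftComm k B B B).toLinearMap ∘ₗ
    (comul (R := k) (A := B)).lTensor B ∘ₗ comul (R := k) (A := B)

/-- `σ` is the `R`-module structure on `Hom(U, 𝔾ₐ)`, for the kernel `U` of `G → R`, that is induced
by the conjugation action of `G` on `U`. There is exactly one, because `U` acts trivially. -/
def IsConjModule (q : O →ₐc[k] B) (σ : GModule k O (homGa k (KernelRing q))) : Prop :=
  ∀ (b : B) (hb : Ideal.Quotient.mk (kernelIdeal q) b ∈ homGa k (KernelRing q)),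
    (Ideal.Quotient.mkₐ k (kernelIdeal q)).toLinearMap.rTensor B (conjCoact k B b) =
      TensorProduct.map (homGa k (KernelRing q)).subtype (q : O →ₗ[k] B) (σ.coact ⟨_, hb⟩)

/-- For an `R`-module `P` and a homomorphism `w : 𝔾ₘ → R`, the subspace of the dual of `P` on which
`𝔾ₘ` acts by the `m`-th power of the standard character; the dual carries the contragredient
action `(t • x)(f) = x(t⁻¹ • f)`. -/
def dualWeightSpace {P : Type*} [AddCommGroup P] [Module k P] (σ : GModule k O P)
    (w : O →ₐc[k] k[T;T⁻¹]) (m : ℤ) : Submodule k (Module.Dual k P) where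
  carrier := {x | ∀ f, x.rTensor k[T;T⁻¹] ((σ.res w).coact f) =
    x f ⊗ₜ[k] (LaurentPolynomial.T (-m) : k[T;T⁻¹])}
  add_mem' := by
    intro a b ha hb f
    rw [LinearMap.rTensor_add, LinearMap.add_apply, ha f, hb f, LinearMap.add_apply,
      TensorProduct.add_tmul]
  zero_mem' := by intro f; simp
  smul_mem' := by
    intro c a ha f
    rw [LinearMap.rTensor_smul, LinearMap.smul_apply, ha f, LinearMap.smul_apply,
      TensorProduct.smul_tmul']

/-- The homomorphism `G → R` of algebraic groups with comorphism `q` is a negatively weighted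
extension of `R` with respect to `w : 𝔾ₘ → R`: it is a quotient map with unipotent kernel `U`, and
`H₁(U)`, as a `𝔾ₘ`-module via `w`, has no weights `m ≥ 0`. -/
structure IsNegWeightedAlg (w : O →ₐc[k] k[T;T⁻¹]) (q : O →ₐc[k] B) : Prop where
  finiteType : Algebra.FiniteType k B
  faithfullyFlat : ((q : O →ₐ[k] B) : O →+* B).FaithfullyFlat
  unipotent : IsUnipotent k (KernelRing q)
  negative : ∃ σ : GModule k O (homGa k (KernelRing q)), IsConjModule q σ ∧
    ∀ m : ℤ, 0 ≤ m → (dualWeightSpace σ w m : Submodule k (H₁ k (KernelRing q))) = ⊥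

end Extensions

/-- The proalgebraic group `G` over `R`, with comorphism `p : O(R) → O(G)`, is a negatively weighted
extension of `R` with respect to `w`: it is the inverse limit of negatively weighted algebraic
extensions `G_α → R` along surjections `G → G_α` over `R`. In terms of coordinate rings, `O(G)` is
the directed union of Hopf subalgebras `O(G_α)` over `O(R)`. -/
def IsNegWeighted {k : Type u} [Field k] {O : Type r} [CommRing O] [HopfAlgebra k O]
    {A : Type g} [CommRing A] [HopfAlgebra k A]
    (w : O →ₐc[k] k[T;T⁻¹]) (p : O →ₐc[k] A) : Prop :=
  ∀ s : Finset A, ∃ (B : Type g) (_ : CommRing B) (_ : HopfAlgebra k B)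
    (q : O →ₐc[k] B) (j : B →ₐc[k] A),
    Function.Injective j ∧ j.comp q = p ∧ (∀ a ∈ s, ∃ b, j b = a) ∧ IsNegWeightedAlg w q

/-- A negatively weighted extension: an algebraic group `R` with a central cocharacter `w`, and
a proalgebraic group `G` that is a negatively weighted extension of `R` with respect to `w`. -/
structure NegWeightedExt (k : Type u) [Field k] where
  /-- the coordinate ring of `R` -/
  OR : Type r
  [commRingOR : CommRing OR]
  [hopfOR : HopfAlgebra k OR]
  /-- the coordinate ring of `G` -/
  OG : Type g
  [commRingOG : CommRing OG]
  [hopfOG : HopfAlgebra k OG]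
  finiteType : Algebra.FiniteType k OR
  w : OR →ₐc[k] k[T;T⁻¹]
  /-- the image of `𝔾ₘ` is central: `w(t) x = x w(t)` for all points `t` of `𝔾ₘ`, `x` of `R` -/
  central : ∀ f : OR,
    (w : OR →ₗ[k] k[T;T⁻¹]).rTensor OR (comul (R := k) f) =
      TensorProduct.comm k OR k[T;T⁻¹]
        ((w : OR →ₗ[k] k[T;T⁻¹]).lTensor OR (comul (R := k) f))
  p : OR →ₐc[k] OG
  negWeighted : IsNegWeighted w p

attribute [instance] NegWeightedExt.commRingOR NegWeightedExt.hopfOR NegWeightedExt.commRingOG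
  NegWeightedExt.hopfOG

/-! ### The category of weighted modules -/

/-- A weighted module: a finite dimensional `G`-module for a negatively weighted extension
`G` of `R`. -/
structure WeightedModule (k : Type u) [Field k] where
  E : NegWeightedExt.{u, r, g} k
  V : Type v
  [addCommGroup : AddCommGroup V]
  [module : Module k V]
  [finite : Module.Finite k V]
  rep : GModule k E.OG V

attribute [instance] WeightedModule.addCommGroup WeightedModule.module WeightedModule.finite

namespace WeightedModule

variable {k : Type u} [Field k]

/-- A morphism of weighted modules: compatible homomorphisms `Φ : G₁ → G₂` and
`φ : R₁ → R₂` with `φ ∘ w₁ = w₂`, and a `G₁`-equivariant linear map `f : V₁ → V₂`, where `V₂` is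
a `G₁`-module via `Φ`. -/
@[ext]
structure Hom (M N : WeightedModule.{u, r, g, v} k) where
  Φ : N.E.OG →ₐc[k] M.E.OG
  φ : N.E.OR →ₐc[k] M.E.OR
  comm_p : Φ.comp N.E.p = M.E.p.comp φ
  comm_w : M.E.w.comp φ = N.E.w
  f : M.V →ₗ[k] N.V
  equivariant : IsGHom M.rep (N.rep.res Φ) f

instance : Category (WeightedModule.{u, r, g, v} k) where
  Hom := Hom
  id M :=
    { Φ := BialgHom.id k _
      φ := BialgHom.id k _
      comm_p := by rw [BialgHom.id_comp, BialgHom.comp_id]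
      comm_w := by rw [BialgHom.comp_id]
      f := LinearMap.id
      equivariant := fun x => by
        change (LinearMap.id).lTensor M.V (M.rep.coact x) = _
        simp }
  comp {L M N} a b :=
    { Φ := a.Φ.comp b.Φ
      φ := a.φ.comp b.φ
      comm_p := by
        rw [BialgHom.comp_assoc, b.comm_p, ← BialgHom.comp_assoc, a.comm_p, BialgHom.comp_assoc]
      comm_w := by rw [← BialgHom.comp_assoc, a.comm_w, b.comm_w]
      f := b.f ∘ₗ a.f
      equivariant := fun x => by
        have ha := a.equivariant x
        have hb := b.equivariant (a.f x)
        simp only [GModule.res, LinearMap.comp_apply] at ha hb ⊢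
        have h1 : (((a.Φ.comp b.Φ : N.E.OG →ₐc[k] L.E.OG)) : N.E.OG →ₗ[k] L.E.OG) =
          (a.Φ : M.E.OG →ₗ[k] L.E.OG) ∘ₗ (b.Φ : N.E.OG →ₗ[k] M.E.OG) := rfl
        rw [h1, LinearMap.lTensor_comp, LinearMap.comp_apply, hb, LinearMap.rTensor_comp,
          LinearMap.comp_apply, ← ha]
        induction M.rep.coact (a.f x) with
        | zero => simp
        | add y z hy hz => simp only [map_add, hy, hz]
        | tmul y z => simp }

/-- The underlying linear map of a morphism. -/
def linearMap {M N : WeightedModule.{u, r, g, v} k} (f : M ⟶ N) : M.V →ₗ[k] N.V := Hom.f f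

end WeightedModule

/-! ### Filtrations and strictness -/

section Filtrations

variable {k : Type u} [Field k]
variable {V V₁ V₂ V₃ : Type*} [AddCommGroup V] [Module k V] [AddCommGroup V₁] [Module k V₁]
  [AddCommGroup V₂] [Module k V₂] [AddCommGroup V₃] [Module k V₃]

/-- `W_{m-1} V` as a subspace of `W_m V` (for an increasing filtration). -/
abbrev prev (F : ℤ → Submodule k V) (m : ℤ) : Submodule k (F m) := (F (m - 1)).submoduleOf (F m)

/-- `Gr_m V = W_m V / W_{m-1} V`. -/
abbrev Gr (F : ℤ → Submodule k V) (m : ℤ) : Type _ := F m ⧸ prev F m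

/-- The linear map `f` preserves the filtrations. -/
def Preserves (F₁ : ℤ → Submodule k V₁) (F₂ : ℤ → Submodule k V₂) (f : V₁ →ₗ[k] V₂) : Prop :=
  ∀ m, ∀ x ∈ F₁ m, f x ∈ F₂ m

/-- The linear map `f` is strict with respect to the filtrations. -/
def IsStrict (F₁ : ℤ → Submodule k V₁) (F₂ : ℤ → Submodule k V₂) (f : V₁ →ₗ[k] V₂) : Prop :=
  Preserves F₁ F₂ f ∧ ∀ m, LinearMap.range f ⊓ F₂ m = (F₁ m).map f

variable {F₁ : ℤ → Submodule k V₁} {F₂ : ℤ → Submodule k V₂} {f : V₁ →ₗ[k] V₂}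

/-- The induced map `W_m V₁ → W_m V₂`. -/
def mapW (h : Preserves F₁ F₂ f) (m : ℤ) : F₁ m →ₗ[k] F₂ m := f.restrict (h m)

/-- The induced map `Gr_m V₁ → Gr_m V₂`. -/
def mapGr (h : Preserves F₁ F₂ f) (m : ℤ) : Gr F₁ m →ₗ[k] Gr F₂ m :=
  Submodule.mapQ _ _ (mapW h m) fun x hx => h (m - 1) x hx

/-- The induced map `V₁ / W_m V₁ → V₂ / W_m V₂`. -/
def mapQuot (h : Preserves F₁ F₂ f) (m : ℤ) : (V₁ ⧸ F₁ m) →ₗ[k] (V₂ ⧸ F₂ m) :=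
  Submodule.mapQ _ _ f (h m)

/-- `0 → V₁ → V₂ → V₃ → 0` is a short exact sequence. -/
def ShortExact (a : V₁ →ₗ[k] V₂) (b : V₂ →ₗ[k] V₃) : Prop :=
  Function.Injective a ∧ Function.Exact a b ∧ Function.Surjective b

end Filtrations

/-- `F` is a weight filtration of the weighted module `M`: a finite increasing filtration
by `G`-submodules such that the action of `G` on each `Gr_m V` factors through an action of `R`, and
`𝔾ₘ` acts on `Gr_m V` via `w` with weight `m`. -/
structure IsWeightFiltration {k : Type u} [Field k] (M : WeightedModule.{u, r, g, v} k)
    (F : ℤ → Submodule k M.V) : Prop where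
  mono : Monotone F
  eq_bot : ∃ a, F a = ⊥
  eq_top : ∃ b, F b = ⊤
  graded : ∀ m, ∃ σ : GModule k M.E.OG (F m), IsGHom σ M.rep (F m).subtype ∧
    ∃ τ : GModule k M.E.OR (Gr F m), IsGHom σ (τ.res M.E.p) (prev F m).mkQ ∧
      τ.weightSpace M.E.w m = ⊤

end NegWt

end

noncomputable section

namespace NegWt

open Coalgebra HopfAlgebra LaurentPolynomial

/-! ### Slices and the action of linear functionals -/

section Slices

variable {k : Type u} [Field k] {V V' C D : Type*} [AddCommGroup V] [Module k V]
  [AddCommGroup V'] [Module k V'] [AddCommGroup C] [Module k C] [AddCommGroup D] [Module k D]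

/-! A linear functional on `O(G)` acts on every `G`-module, and composition of these operators is
convolution of functionals. So `G`-modules become modules over the dual algebra of `O(G)`, and
identities between coactions can be tested on functionals. A subquotient is pure of weight `m` when
`α` acts on it by the scalar `β (T m)` for all functionals `α` on `O(G)` and `β` on `O(𝔾ₘ)` with the
same pullback to `O(R)`. Taking `β = 0` says that the action factors through `R`; the remaining
pairs say that `w` acts with weight `m` (`isWeightFiltration_iff`).

A subquotient that is pure of two different weights is zero. This gives `le_of_pure`, hence
uniqueness. It also gives strictness, since the image filtration and the induced filtration on `im
f` both have pure graded pieces.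

For existence, `W n` is the largest submodule built from pure pieces of weights at most `n`. Two
facts make it work (`exists_isWF`). Every nonzero quotient has a nonzero pure submodule: the
unipotent kernel `U` fixes a vector, faithfully flat descent makes the fixed vectors a module over
`R`, and the central `w` splits that module into weight parts. Moreover, a weight `b` on top of a
weight `a ≥ b` never involves `U` (`descentPart_eq_top`): the action of `U` on such an extension is
given by elements of `Hom(U, 𝔾ₐ)` of weight `-(a - b)`, which vanish because `H₁(U)` has no weight
`a - b ≥ 0`. The extension is then an `R`-module and `w` splits it. Hence weights `≤ n` can always
be moved below weights `> n`, and two pieces of weight `n` glue to a pure one.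

A finite-dimensional module involves finitely many matrix coefficients, so the proalgebraic case
reduces to an algebraic quotient. The formulas for lifts of `w` come from weight projections; those
for tensor products and Homs come from uniqueness, by checking that the candidates are weight
filtrations. Exactness is formal from strictness. -/

/-- The map `v ⊗ c ↦ α c • v`. -/
def slice (V : Type*) [AddCommGroup V] [Module k V] (α : C →ₗ[k] k) : V ⊗[k] C →ₗ[k] V :=
  (TensorProduct.rid k V).toLinearMap ∘ₗ α.lTensor V

@[simp]
lemma slice_tmul (α : C →ₗ[k] k) (v : V) (c : C) : slice V α (v ⊗ₜ c) = α c • v := by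
  simp [slice]

lemma slice_lTensor (α : D →ₗ[k] k) (f : C →ₗ[k] D) (x : V ⊗[k] C) :
    slice V α (f.lTensor V x) = slice V (α ∘ₗ f) x := by
  simp [slice, LinearMap.lTensor_comp]

lemma slice_rTensor (α : C →ₗ[k] k) (f : V →ₗ[k] V') (x : V ⊗[k] C) :
    slice V' α (f.rTensor C x) = f (slice V α x) := by
  induction x with
  | zero => simp
  | add x y hx hy => simp only [map_add, hx, hy]
  | tmul v c => simp

lemma slice_sub (α β : C →ₗ[k] k) (x : V ⊗[k] C) :
    slice V (α - β) x = slice V α x - slice V β x := by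
  simp [slice, LinearMap.lTensor_sub]

lemma slice_smul (c : k) (α : C →ₗ[k] k) (x : V ⊗[k] C) :
    slice V (c • α) x = c • slice V α x := by
  simp [slice, LinearMap.lTensor_smul]

lemma eq_zero_of_slice {x : V ⊗[k] C} (h : ∀ α : C →ₗ[k] k, slice V α x = 0) : x = 0 := by
  classical
  let b := Module.Basis.ofVectorSpace k C
  apply (TensorProduct.equivFinsuppOfBasisRight b).injective
  ext i
  rw [TensorProduct.equivFinsuppOfBasisRight_apply]
  simpa [slice] using h (b.coord i)

lemma ext_slice {x y : V ⊗[k] C} (h : ∀ α : C →ₗ[k] k, slice V α x = slice V α y) : x = y := by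
  rw [← sub_eq_zero]
  apply eq_zero_of_slice
  intro α
  rw [map_sub, h, sub_self]

lemma slice_mem {N : Submodule k V} {x : V ⊗[k] C}
    (hx : x ∈ LinearMap.range (N.subtype.rTensor C)) (α : C →ₗ[k] k) : slice V α x ∈ N := by
  obtain ⟨y, rfl⟩ := hx
  rw [slice_rTensor]
  exact (slice N α y).2

/-- A linear retraction `V → N` is the identity on every slice, so it reproduces `x`. This turns
conditions on all slices into an element of `N ⊗ C`, on which one can induct over pure tensors. -/
lemma mem_range_rTensor {N : Submodule k V} {x : V ⊗[k] C} :
    x ∈ LinearMap.range (N.subtype.rTensor C) ↔ ∀ α : C →ₗ[k] k, slice V α x ∈ N := by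
  refine ⟨slice_mem, fun h => ?_⟩
  obtain ⟨π, hπ⟩ := N.subtype.exists_leftInverse_of_injective N.ker_subtype
  refine ⟨π.rTensor C x, ext_slice fun α => ?_⟩
  rw [slice_rTensor, slice_rTensor]
  have := LinearMap.congr_fun hπ ⟨_, h α⟩
  exact congrArg Subtype.val this

lemma exists_dual_extend {f : C →ₗ[k] D} (hf : Function.Injective f) (γ : C →ₗ[k] k) :
    ∃ α : D →ₗ[k] k, α ∘ₗ f = γ := by
  obtain ⟨r, hr⟩ := f.exists_leftInverse_of_injective (LinearMap.ker_eq_bot.mpr hf)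
  exact ⟨γ ∘ₗ r, by rw [LinearMap.comp_assoc, hr, LinearMap.comp_id]⟩

/-- If all functionals that vanish on the image of `f` have zero slice at `x`, then `x` comes from
`V ⊗ C`. -/
lemma mem_range_lTensor {f : C →ₗ[k] D} (hf : Function.Injective f) {x : V ⊗[k] D}
    (h : ∀ α : D →ₗ[k] k, α ∘ₗ f = 0 → slice V α x = 0) : ∃ z : V ⊗[k] C, f.lTensor V z = x := by
  obtain ⟨r, hr⟩ := f.exists_leftInverse_of_injective (LinearMap.ker_eq_bot.mpr hf)
  refine ⟨r.lTensor V x, ext_slice fun α => ?_⟩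
  rw [slice_lTensor, slice_lTensor, ← sub_eq_zero, ← slice_sub]
  apply h
  rw [LinearMap.sub_comp, LinearMap.comp_assoc, LinearMap.comp_assoc, hr, LinearMap.comp_id,
    sub_self]

/-- The tensor product of two functionals. -/
def dualMul (α : C →ₗ[k] k) (β : D →ₗ[k] k) : C ⊗[k] D →ₗ[k] k :=
  LinearMap.mul' k k ∘ₗ TensorProduct.map α β

@[simp]
lemma dualMul_tmul (α : C →ₗ[k] k) (β : D →ₗ[k] k) (c : C) (d : D) :
    dualMul α β (c ⊗ₜ d) = α c * β d := by
  simp [dualMul]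

end Slices

/-! ### Modules over the convolution algebra of functionals -/

section Action

variable {k : Type u} [Field k] {A B O : Type*} [CommRing A] [HopfAlgebra k A]
  [CommRing B] [HopfAlgebra k B] [CommRing O] [HopfAlgebra k O]
  {V V' : Type*} [AddCommGroup V] [Module k V] [AddCommGroup V'] [Module k V']

/-- The convolution product of functionals on `O(G)`. -/
def conv (α β : A →ₗ[k] k) : A →ₗ[k] k := dualMul α β ∘ₗ comul

lemma conv_comp (α β : B →ₗ[k] k) (φ : A →ₐc[k] B) :
    conv α β ∘ₗ (φ : A →ₗ[k] B) = conv (α ∘ₗ (φ : A →ₗ[k] B)) (β ∘ₗ (φ : A →ₗ[k] B)) := by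
  ext a
  simp only [conv, LinearMap.comp_apply]
  have := CoalgHomClass.map_comp_comul_apply φ a
  change dualMul α β (comul (R := k) (φ a)) = _
  rw [← this]
  generalize comul (R := k) a = z
  induction z with
  | zero => simp
  | add x y hx hy => simp only [map_add, hx, hy]
  | tmul v c => simp

/-- The action of a functional on `O(G)` on a `G`-module. -/
def GModule.op (ρ : GModule k A V) (α : A →ₗ[k] k) : V →ₗ[k] V := slice V α ∘ₗ ρ.coact

lemma GModule.op_apply (ρ : GModule k A V) (α : A →ₗ[k] k) (v : V) :
    ρ.op α v = slice V α (ρ.coact v) := rfl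

lemma GModule.op_sub (ρ : GModule k A V) (α β : A →ₗ[k] k) (v : V) :
    ρ.op (α - β) v = ρ.op α v - ρ.op β v := slice_sub _ _ _

lemma GModule.op_smul (ρ : GModule k A V) (c : k) (α : A →ₗ[k] k) (v : V) :
    ρ.op (c • α) v = c • ρ.op α v := slice_smul _ _ _

lemma GModule.op_counit (ρ : GModule k A V) (v : V) : ρ.op counit v = v := by
  simp [GModule.op_apply, slice, ρ.counit_coact]

/-- Coassociativity, read through functionals: a `G`-module is a left module over the convolution
algebra. -/
lemma GModule.op_op (ρ : GModule k A V) (α β : A →ₗ[k] k) (v : V) :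
    ρ.op α (ρ.op β v) = ρ.op (conv α β) v := by
  have h : ∀ x : V ⊗[k] A, ρ.op α (slice V β x) =
      slice V (dualMul α β) (TensorProduct.assoc k V A A (ρ.coact.rTensor A x)) := by
    intro x
    induction x with
    | zero => simp
    | add x y hx hy => simp only [map_add, hx, hy]
    | tmul w a =>
      simp only [slice_tmul, map_smul, LinearMap.rTensor_tmul, GModule.op_apply]
      induction ρ.coact w with
      | zero => simp
      | add x y hx hy => simp only [map_add, smul_add, TensorProduct.add_tmul, hx, hy]
      | tmul v b => simp [smul_smul, mul_comm]
  rw [ρ.op_apply β, h, ρ.coassoc, slice_lTensor]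
  rfl

lemma GModule.op_res (ρ : GModule k A V) (φ : A →ₐc[k] B) (α : B →ₗ[k] k) :
    (ρ.res φ).op α = ρ.op (α ∘ₗ (φ : A →ₗ[k] B)) := by
  ext v
  simp only [GModule.op_apply, GModule.res, LinearMap.comp_apply, slice_lTensor]

lemma isGHom_iff (ρ : GModule k A V) (σ : GModule k A V') (f : V →ₗ[k] V') :
    IsGHom ρ σ f ↔ ∀ α v, σ.op α (f v) = f (ρ.op α v) := by
  refine ⟨fun h α v => ?_, fun h v => ext_slice fun α => ?_⟩
  · rw [GModule.op_apply, h v, slice_rTensor, GModule.op_apply]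
  · rw [slice_rTensor]
    exact h α v

/-- A linear map with the coassociativity and counit properties tested against functionals is a
coaction. -/
def GModule.ofOp (c : V →ₗ[k] V ⊗[k] A)
    (h1 : ∀ α β v, slice V α (c (slice V β (c v))) = slice V (conv α β) (c v))
    (h2 : ∀ v, slice V counit (c v) = v) : GModule k A V where
  coact := c
  coassoc v := by
    apply (TensorProduct.assoc k V A A).symm.injective
    rw [LinearEquiv.symm_apply_apply]
    apply ext_slice
    intro β
    apply ext_slice
    intro α
    have e1 : ∀ x : V ⊗[k] A, slice V α (slice (V ⊗[k] A) β (c.rTensor A x)) =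
        slice V α (c (slice V β x)) := by
      intro x
      rw [slice_rTensor]
    have e2 : ∀ x : V ⊗[k] (A ⊗[k] A), slice V α (slice (V ⊗[k] A) β
        ((TensorProduct.assoc k V A A).symm x)) = slice V (dualMul α β) x := by
      intro x
      induction x with
      | zero => simp
      | add x y hx hy => simp only [map_add, hx, hy]
      | tmul v y =>
        induction y with
        | zero => simp
        | add x y hx hy => simp only [map_add, TensorProduct.tmul_add, hx, hy]
        | tmul a b => simp [smul_smul, mul_comm]
    rw [e1, e2, h1, slice_lTensor]
    rfl
  counit_coact v := by
    apply (TensorProduct.rid k V).injective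
    simpa [slice] using h2 v

/-- The subspace `N` is a `G`-submodule. -/
def IsStable (ρ : GModule k A V) (N : Submodule k V) : Prop := ∀ α, ∀ v ∈ N, ρ.op α v ∈ N

lemma IsStable.sup {ρ : GModule k A V} {N N' : Submodule k V} (h : IsStable ρ N)
    (h' : IsStable ρ N') : IsStable ρ (N ⊔ N') := by
  intro α v hv
  obtain ⟨x, hx, y, hy, rfl⟩ := Submodule.mem_sup.mp hv
  rw [map_add]
  exact Submodule.add_mem_sup (h α x hx) (h' α y hy)

lemma IsStable.inf {ρ : GModule k A V} {N N' : Submodule k V} (h : IsStable ρ N)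
    (h' : IsStable ρ N') : IsStable ρ (N ⊓ N') :=
  fun α v hv => ⟨h α v hv.1, h' α v hv.2⟩

/-- The restriction of the action to a `G`-submodule. -/
lemma IsStable.exists_sub {ρ : GModule k A V} {N : Submodule k V} (h : IsStable ρ N) :
    ∃ σ : GModule k A N, ∀ α (v : N), (σ.op α v : V) = ρ.op α v := by
  obtain ⟨π, hπ⟩ := N.subtype.exists_leftInverse_of_injective N.ker_subtype
  have key : ∀ (α : A →ₗ[k] k) (v : N),
      ((slice N α (π.rTensor A (ρ.coact v)) : N) : V) = ρ.op α v := by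
    intro α v
    rw [slice_rTensor]
    exact congrArg Subtype.val (LinearMap.congr_fun hπ ⟨_, h α v v.2⟩)
  refine ⟨GModule.ofOp (π.rTensor A ∘ₗ ρ.coact ∘ₗ N.subtype) (fun α β v => ?_) (fun v => ?_), key⟩
  · apply Subtype.ext
    simp only [LinearMap.comp_apply, Submodule.subtype_apply]
    rw [key, key, key, ρ.op_op]
  · apply Subtype.ext
    simp only [LinearMap.comp_apply, Submodule.subtype_apply]
    rw [key, ρ.op_counit]

/-- The quotient by a `G`-submodule. -/
lemma IsStable.exists_quot {ρ : GModule k A V} {N : Submodule k V} (h : IsStable ρ N) :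
    ∃ σ : GModule k A (V ⧸ N), ∀ α v, σ.op α (N.mkQ v) = N.mkQ (ρ.op α v) := by
  let c : (V ⧸ N) →ₗ[k] (V ⧸ N) ⊗[k] A := N.liftQ (N.mkQ.rTensor A ∘ₗ ρ.coact) (by
    intro v hv
    apply eq_zero_of_slice
    intro α
    rw [LinearMap.comp_apply, slice_rTensor]
    exact (Submodule.Quotient.mk_eq_zero N).mpr (h α v hv))
  have key : ∀ (α : A →ₗ[k] k) (v : V), slice _ α (c (N.mkQ v)) = N.mkQ (ρ.op α v) := by
    intro α v
    exact slice_rTensor α N.mkQ (ρ.coact v)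
  refine ⟨GModule.ofOp c (fun α β v => ?_) (fun v => ?_), key⟩
  · obtain ⟨v, rfl⟩ := N.mkQ_surjective v
    rw [key, key, key, ρ.op_op]
  · obtain ⟨v, rfl⟩ := N.mkQ_surjective v
    rw [key, ρ.op_counit]

/-- Corestriction: a `G`-module all of whose coefficients lie in `O(H)` is an `H`-module. -/
lemma GModule.exists_res_eq (ρ : GModule k A V) {φ : B →ₐc[k] A} (hφ : Function.Injective φ)
    (h : ∀ α : A →ₗ[k] k, α ∘ₗ (φ : B →ₗ[k] A) = 0 → ∀ v, ρ.op α v = 0) :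
    ∃ τ : GModule k B V, τ.res φ = ρ := by
  obtain ⟨r, hr⟩ := (φ : B →ₗ[k] A).exists_leftInverse_of_injective (LinearMap.ker_eq_bot.mpr hφ)
  -- `φ ∘ r` is a projection onto `O(H)`; the difference of `α` and its composite with it vanishes
  -- on `O(H)`, hence acts by zero.
  have key0 : ∀ (α : A →ₗ[k] k) (v : V), ρ.op (α ∘ₗ (φ : B →ₗ[k] A) ∘ₗ r) v = ρ.op α v := by
    intro α v
    rw [← sub_eq_zero, ← ρ.op_sub]
    apply h
    rw [LinearMap.sub_comp, LinearMap.comp_assoc, LinearMap.comp_assoc, hr, LinearMap.comp_id,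
      sub_self]
  have key : ∀ (α : B →ₗ[k] k) (v : V), slice V α (r.lTensor V (ρ.coact v)) =
      ρ.op (α ∘ₗ r) v := fun α v => slice_lTensor _ _ _
  have e : ∀ α : B →ₗ[k] k, (α ∘ₗ r) ∘ₗ (φ : B →ₗ[k] A) = α := fun α => by
    rw [LinearMap.comp_assoc, hr, LinearMap.comp_id]
  refine ⟨GModule.ofOp (r.lTensor V ∘ₗ ρ.coact) (fun α β v => ?_) (fun v => ?_), ?_⟩
  · simp only [LinearMap.comp_apply]
    rw [key, key, key, ρ.op_op, ← key0 (conv (α ∘ₗ r) (β ∘ₗ r)), ← LinearMap.comp_assoc,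
      conv_comp, e, e]
  · simp only [LinearMap.comp_apply]
    rw [key]
    have : (counit : A →ₗ[k] k) ∘ₗ (φ : B →ₗ[k] A) = counit := by
      ext b
      exact CoalgHomClass.counit_comp_apply φ b
    rw [← this, LinearMap.comp_assoc, key0, ρ.op_counit]
  · ext v
    change (φ : B →ₗ[k] A).lTensor V (r.lTensor V (ρ.coact v)) = _
    apply ext_slice
    intro α
    rw [slice_lTensor, slice_lTensor, LinearMap.comp_assoc]
    exact key0 α v

end Action

/-! ### Pure subquotients and weight filtrations -/

section Pure

variable {k : Type u} [Field k] {A O : Type*} [CommRing A] [HopfAlgebra k A]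
  [CommRing O] [HopfAlgebra k O] {V : Type*} [AddCommGroup V] [Module k V]

/-- The functionals `α` on `O(G)` and `β` on `O(𝔾ₘ)` have the same image on `O(R)`. -/
def Compat (p : O →ₐc[k] A) (w : O →ₐc[k] k[T;T⁻¹]) (α : A →ₗ[k] k) (β : k[T;T⁻¹] →ₗ[k] k) :
    Prop :=
  α ∘ₗ (p : O →ₗ[k] A) = β ∘ₗ (w : O →ₗ[k] k[T;T⁻¹])

/-- The action of `G` on `N / N'` factors through `R`, and `𝔾ₘ` acts on it by the `m`-th power of
the standard character. -/
def IsPure (ρ : GModule k A V) (p : O →ₐc[k] A) (w : O →ₐc[k] k[T;T⁻¹]) (m : ℤ)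
    (N' N : Submodule k V) : Prop :=
  ∀ α β, Compat p w α β → ∀ v ∈ N, ρ.op α v - β (T m) • v ∈ N'

lemma Compat.apply {p : O →ₐc[k] A} {w : O →ₐc[k] k[T;T⁻¹]} {α : A →ₗ[k] k}
    {β : k[T;T⁻¹] →ₗ[k] k} (h : Compat p w α β) (o : O) : α (p o) = β (w o) :=
  LinearMap.congr_fun h o

/-- The coefficient of `T ^ m`, as a functional. -/
def coeffT (k : Type u) [Field k] (m : ℤ) : k[T;T⁻¹] →ₗ[k] k :=
  Finsupp.lapply m ∘ₗ (AddMonoidAlgebra.coeffLinearEquiv k).toLinearMap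

lemma coeffT_T (m n : ℤ) : coeffT k m (T n) = if n = m then 1 else 0 := by
  simp [coeffT, T, Finsupp.single_apply, -single_eq_C_mul_T]

/-- The basis of `k[T;T⁻¹]` given by the powers of `T`. -/
def laurentBasis (k : Type u) [Field k] : Module.Basis ℤ k k[T;T⁻¹] :=
  .ofRepr (AddMonoidAlgebra.coeffLinearEquiv k)

lemma laurent_hom_ext {β γ : k[T;T⁻¹] →ₗ[k] k} (h : ∀ n : ℤ, β (T n) = γ (T n)) : β = γ :=
  (laurentBasis k).ext h

variable {ρ : GModule k A V} {p : O →ₐc[k] A} {w : O →ₐc[k] k[T;T⁻¹]}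

lemma IsPure.mono {m : ℤ} {N' N M' M : Submodule k V} (h : IsPure ρ p w m N' N) (h' : N' ≤ M')
    (h'' : M ≤ N) : IsPure ρ p w m M' M :=
  fun α β hc v hv => h' (h α β hc v (h'' hv))

lemma IsPure.sup_right {m : ℤ} {N' N : Submodule k V} (h : IsPure ρ p w m N' N)
    {M : Submodule k V} (hM : IsStable ρ M) : IsPure ρ p w m (N' ⊔ M) (N ⊔ M) := by
  intro α β hc v hv
  obtain ⟨x, hx, y, hy, rfl⟩ := Submodule.mem_sup.mp hv
  rw [map_add, smul_add, add_sub_add_comm]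
  exact Submodule.add_mem_sup (h α β hc x hx) (M.sub_mem (hM α y hy) (M.smul_mem _ hy))

lemma IsPure.inf_right {m : ℤ} {N' N : Submodule k V} (h : IsPure ρ p w m N' N)
    {M : Submodule k V} (hM : IsStable ρ M) : IsPure ρ p w m (N' ⊓ M) (N ⊓ M) := by
  intro α β hc v hv
  exact ⟨h α β hc v hv.1, M.sub_mem (hM α v hv.2) (M.smul_mem _ hv.2)⟩

lemma exists_compat (hp : Function.Injective p) (w : O →ₐc[k] k[T;T⁻¹]) (β : k[T;T⁻¹] →ₗ[k] k) :
    ∃ α : A →ₗ[k] k, Compat p w α β :=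
  exists_dual_extend (f := (p : O →ₗ[k] A)) hp _

/-- A vector that spans a subquotient of two different weights vanishes. -/
lemma mem_of_pure_of_pure (hp : Function.Injective p) {m l : ℤ} (hml : m ≠ l) {N : Submodule k V}
    {v : V} (h1 : ∀ α β, Compat p w α β → ρ.op α v - β (T m) • v ∈ N)
    (h2 : ∀ α β, Compat p w α β → ρ.op α v - β (T l) • v ∈ N) : v ∈ N := by
  -- The coefficient functional at `l` acts as `0` by purity of weight `m` and as the identity by
  -- purity of weight `l`; the difference of the two congruences is `v`.
  obtain ⟨α, hα⟩ := exists_compat hp w (coeffT k l)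
  have := N.sub_mem (h1 α _ hα) (h2 α _ hα)
  simpa [coeffT_T, hml] using this

/-- A weight filtration of a `G`-module, in terms of the action of functionals. -/
structure IsWF (ρ : GModule k A V) (p : O →ₐc[k] A) (w : O →ₐc[k] k[T;T⁻¹])
    (F : ℤ → Submodule k V) : Prop where
  mono : Monotone F
  eq_bot : ∃ a, F a = ⊥
  eq_top : ∃ b, F b = ⊤
  stable : ∀ m, IsStable ρ (F m)
  pure : ∀ m, IsPure ρ p w m (F (m - 1)) (F m)

/-- There is no nonzero map from weights at most `n` to weights greater than `n`. The filtration `F`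
is climbed from its bottom and, at each stage, `F'` is descended from its top to `n`. Since `F'`
need only contain all of `F`, not all of `V`, the lemma also applies to filtrations of a submodule
such as an image. -/
lemma le_of_pure (hp : Function.Injective p) {F F' : ℤ → Submodule k V}
    (hF : Monotone F) (hF' : Monotone F') (h0 : ∃ a, F a = ⊥) (h1 : ∃ b, ∀ n, F n ≤ F' b)
    (hpF : ∀ m, IsPure ρ p w m (F (m - 1)) (F m))
    (hpF' : ∀ m, IsPure ρ p w m (F' (m - 1)) (F' m)) (n : ℤ) : F n ≤ F' n := by
  obtain ⟨a, ha⟩ := h0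
  obtain ⟨b, hb⟩ := h1
  have key : ∀ i : ℕ, a + i ≤ n → F (a + i) ≤ F' n := by
    intro i
    induction i with
    | zero => intro _; simp [ha]
    | succ i ih =>
      intro hi
      push_cast at hi ⊢
      have ih := ih (by omega)
      -- Modulo the next lower step of `F'`, the vector has weight `a + (i + 1) ≤ n` by `ih`, and
      -- weight `b - j > n`.
      have down : ∀ j : ℕ, n ≤ b - j → F (a + (i + 1)) ≤ F' (b - j) := by
        intro j
        induction j with
        | zero => intro _; simpa using hb _
        | succ j ihj =>
          intro hj
          push_cast at hj ⊢
          have ihj := ihj (by omega)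
          intro v hv
          refine mem_of_pure_of_pure (ρ := ρ) (w := w) hp (m := a + (i + 1)) (l := b - j) (by omega) ?_ ?_
          · intro α β hc
            refine hF' (show n ≤ _ from hj) (ih ?_)
            have := hpF _ α β hc v hv
            rwa [show a + ((i : ℤ) + 1) - 1 = a + i by ring] at this
          · intro α β hc
            have := hpF' _ α β hc v (ihj hv)
            rwa [show b - (j : ℤ) - 1 = b - (j + 1) by ring] at this
      rcases le_total b n with h | h
      · exact (hb _).trans (hF' h)
      · have := down (b - n).toNat (by rw [Int.toNat_of_nonneg (by omega)]; omega)
        rwa [Int.toNat_of_nonneg (by omega), show b - (b - n) = n by ring] at this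
  rcases le_total a n with h | h
  · have := key (n - a).toNat (by rw [Int.toNat_of_nonneg (by omega)]; omega)
    rwa [Int.toNat_of_nonneg (by omega), show a + (n - a) = n by ring] at this
  · exact (hF h).trans (by simp [ha])

lemma IsWF.unique (hp : Function.Injective p) {F F' : ℤ → Submodule k V}
    (h : IsWF ρ p w F) (h' : IsWF ρ p w F') : F = F' := by
  obtain ⟨b, hb⟩ := h.eq_top
  obtain ⟨b', hb'⟩ := h'.eq_top
  funext n
  exact le_antisymm
    (le_of_pure hp h.mono h'.mono h.eq_bot ⟨b', by simp [hb']⟩ h.pure h'.pure n)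
    (le_of_pure hp h'.mono h.mono h'.eq_bot ⟨b, by simp [hb]⟩ h'.pure h.pure n)

/-! ### Existence of the weight filtration from a splitting principle -/

/-- The submodule `N` is a successive extension of pure modules of weights at most `n`. -/
inductive WeightsLE (ρ : GModule k A V) (p : O →ₐc[k] A) (w : O →ₐc[k] k[T;T⁻¹]) (n : ℤ) :
    Submodule k V → Prop
  | bot : WeightsLE ρ p w n ⊥
  | step {N' N : Submodule k V} {m : ℤ} : WeightsLE ρ p w n N' → N' ≤ N → IsStable ρ N →
      IsPure ρ p w m N' N → m ≤ n → WeightsLE ρ p w n N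

/-- The quotient by `N` is a successive extension of pure modules of weights greater than `n`. -/
inductive WeightsGT (ρ : GModule k A V) (p : O →ₐc[k] A) (w : O →ₐc[k] k[T;T⁻¹]) (n : ℤ) :
    Submodule k V → Prop
  | top : WeightsGT ρ p w n ⊤
  | step {N' N : Submodule k V} {m : ℤ} : WeightsGT ρ p w n N → N' ≤ N → IsStable ρ N' →
      IsPure ρ p w m N' N → n < m → WeightsGT ρ p w n N'

lemma isStable_bot : IsStable ρ ⊥ := by
  intro α v hv
  rw [(Submodule.mem_bot k).mp hv, map_zero]
  exact Submodule.zero_mem _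

lemma isStable_top : IsStable ρ ⊤ := fun _ _ _ => Submodule.mem_top

lemma WeightsLE.isStable {n : ℤ} {N : Submodule k V} (h : WeightsLE ρ p w n N) : IsStable ρ N := by
  cases h with
  | bot => exact isStable_bot
  | step _ _ h _ _ => exact h

lemma WeightsGT.isStable {n : ℤ} {N : Submodule k V} (h : WeightsGT ρ p w n N) : IsStable ρ N := by
  cases h with
  | top => exact isStable_top
  | step _ _ h _ _ => exact h

lemma WeightsLE.mono {n n' : ℤ} (hn : n ≤ n') {N : Submodule k V} (h : WeightsLE ρ p w n N) :
    WeightsLE ρ p w n' N := by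
  induction h with
  | bot => exact .bot
  | step _ h1 h2 h3 h4 ih => exact .step ih h1 h2 h3 (h4.trans hn)

lemma WeightsGT.mono {n n' : ℤ} (hn : n' ≤ n) {N : Submodule k V} (h : WeightsGT ρ p w n N) :
    WeightsGT ρ p w n' N := by
  induction h with
  | top => exact .top
  | step _ h1 h2 h3 h4 ih => exact .step ih h1 h2 h3 (hn.trans_lt h4)

lemma WeightsLE.sup {n : ℤ} {N M : Submodule k V} (hN : WeightsLE ρ p w n N)
    (hM : WeightsLE ρ p w n M) : WeightsLE ρ p w n (N ⊔ M) := by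
  induction hN with
  | bot => rwa [bot_sup_eq]
  | step _ h1 h2 h3 h4 ih =>
    exact .step ih (sup_le_sup_right h1 M) (h2.sup hM.isStable) (h3.sup_right hM.isStable) h4

/-- Each pure layer of `M` has weight at most `n < a`, so its intersection with `N` dies modulo
`N'`. -/
lemma WeightsLE.inf_le (hp : Function.Injective p) {n a : ℤ} {M N' N : Submodule k V}
    (hM : WeightsLE ρ p w n M) (hs : IsStable ρ N) (h : IsPure ρ p w a N' N) (ha : n < a) :
    M ⊓ N ≤ N' := by
  induction hM with
  | bot => simp
  | @step M' M m _ h1 h2 h3 h4 ih =>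
    intro v hv
    refine mem_of_pure_of_pure hp (show m ≠ a by omega) (fun α β hc => ih ⟨h3 α β hc v hv.1, ?_⟩)
      (fun α β hc => h α β hc v hv.2)
    exact N.sub_mem (hs α v hv.2) (N.smul_mem _ hv.2)

lemma WeightsLE.le_of_weightsGT (hp : Function.Injective p) {n : ℤ} {M N : Submodule k V}
    (hM : WeightsLE ρ p w n M) (hN : WeightsGT ρ p w n N) : M ≤ N := by
  induction hN with
  | top => exact le_top
  | step h0 _ _ h3 h4 ih =>
    exact (le_inf le_rfl ih).trans (hM.inf_le hp h0.isStable h3 h4)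

/-- Every proper submodule has a nonzero pure submodule in its quotient. -/
def HasPureSub (ρ : GModule k A V) (p : O →ₐc[k] A) (w : O →ₐc[k] k[T;T⁻¹]) : Prop :=
  ∀ N' : Submodule k V, IsStable ρ N' → N' ≠ ⊤ →
    ∃ (N : Submodule k V) (m : ℤ), N' < N ∧ IsStable ρ N ∧ IsPure ρ p w m N' N

/-- Extensions of pure modules of weight `b` by pure modules of weight `a ≥ b` are trivial on the
kernel of `G → R`. -/
def HasSplitting (ρ : GModule k A V) (p : O →ₐc[k] A) (w : O →ₐc[k] k[T;T⁻¹]) : Prop :=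
  ∀ (N₀ N₁ N₂ : Submodule k V) (a b : ℤ), IsStable ρ N₀ → IsStable ρ N₁ → IsStable ρ N₂ →
    N₀ ≤ N₁ → N₁ ≤ N₂ → IsPure ρ p w a N₀ N₁ → IsPure ρ p w b N₁ N₂ → b ≤ a →
    (a = b → IsPure ρ p w a N₀ N₂) ∧
    (b < a → ∃ N, IsStable ρ N ∧ N₀ ≤ N ∧ N ≤ N₂ ∧ N ⊓ N₁ ≤ N₀ ∧ N₂ ≤ N ⊔ N₁)

variable [Module.Finite k V]

lemma exists_weightsLE_top (h1 : HasPureSub ρ p w) : ∃ n, WeightsLE ρ p w n ⊤ := by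
  have : ∀ N : Submodule k V, (∃ n, WeightsLE ρ p w n N) → ∃ n, WeightsLE ρ p w n ⊤ := by
    intro N
    induction N using WellFoundedGT.induction with
    | ind N ih =>
      rintro ⟨n, hn⟩
      by_cases hN : N = ⊤
      · exact ⟨n, hN ▸ hn⟩
      · obtain ⟨N₁, m, hlt, hs, hpure⟩ := h1 N hn.isStable hN
        exact ih N₁ hlt ⟨max n m, .step (hn.mono (le_max_left _ _)) hlt.le hs hpure
          (le_max_right _ _)⟩
  exact this ⊥ ⟨0, .bot⟩

lemma exists_weightsGT (h1 : HasPureSub ρ p w) (N : Submodule k V) (hN : IsStable ρ N) :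
    ∃ n, WeightsGT ρ p w n N := by
  induction N using WellFoundedGT.induction with
  | ind N ih =>
    by_cases hN' : N = ⊤
    · exact ⟨0, hN' ▸ .top⟩
    · obtain ⟨N₁, m, hlt, hs, hpure⟩ := h1 N hN hN'
      obtain ⟨n, hn⟩ := ih N₁ hlt hs
      -- `m - 1` rather than `m`, because the weights in `WeightsGT` are strictly greater than the
      -- bound.
      exact ⟨min n (m - 1), .step (hn.mono (min_le_left _ _)) hlt.le hN hpure
        (by have := min_le_right n (m - 1); omega)⟩

/-- The class is closed under sums and `V` is Noetherian; the greatest element is the candidate for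
`W n`. -/
lemma exists_greatest_weightsLE (ρ : GModule k A V) (p : O →ₐc[k] A) (w : O →ₐc[k] k[T;T⁻¹])
    (n : ℤ) : ∃ W, WeightsLE ρ p w n W ∧ ∀ N, WeightsLE ρ p w n N → N ≤ W := by
  obtain ⟨W, hW, hmax⟩ := WellFounded.has_min (wellFounded_gt (α := Submodule k V))
    {N | WeightsLE ρ p w n N} ⟨⊥, .bot⟩
  refine ⟨W, hW, fun N hN => ?_⟩
  by_contra hlt
  exact hmax (W ⊔ N) (WeightsLE.sup hW hN) (left_lt_sup.mpr hlt)

/-- If the quotient by `N` has no pure submodule of weight at most `n`, then all its weights are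
greater than `n`. -/
lemma weightsGT_of_forall (h1 : HasPureSub ρ p w) (h2 : HasSplitting ρ p w) {n : ℤ}
    (N : Submodule k V) (hN : IsStable ρ N)
    (h : ∀ N₁ m, N ≤ N₁ → IsStable ρ N₁ → IsPure ρ p w m N N₁ → m ≤ n → N₁ ≤ N) :
    WeightsGT ρ p w n N := by
  induction N using WellFoundedGT.induction with
  | ind N ih =>
    by_cases hN' : N = ⊤
    · exact hN' ▸ .top
    · obtain ⟨N₁, a, hlt, hs, hpure⟩ := h1 N hN hN'
      have ha : n < a := by
        by_contra hle
        exact hlt.not_ge (h N₁ a hlt.le hs hpure (not_lt.mp hle))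
      -- It remains to see that `V / N₁` inherits the hypothesis. A piece `N₂ / N₁` of weight `b ≤ n
      -- < a` splits off `N₂ / N`, giving a submodule `M / N` of weight `b`; the hypothesis on `N`
      -- kills it, so `N₂ ≤ N₁`.
      refine .step (ih N₁ hlt hs ?_) hlt.le hN hpure ha
      intro N₂ b h12 hs2 hpure2 hb
      obtain ⟨M, hM, hNM, hMN, hinf, hsup⟩ :=
        (h2 N N₁ N₂ a b hN hs hs2 hlt.le h12 hpure hpure2 (by omega)).2 (by omega)
      have hMpure : IsPure ρ p w b N M := fun α β hc v hv =>
        hinf ⟨M.sub_mem (hM α v hv) (M.smul_mem _ hv), hpure2 α β hc v (hMN hv)⟩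
      have := h M b hNM hM hMpure hb
      exact hsup.trans (sup_le (this.trans hlt.le) le_rfl)

lemma exists_isWF (hp : Function.Injective p) (h1 : HasPureSub ρ p w)
    (h2 : HasSplitting ρ p w) : ∃ F, IsWF ρ p w F := by
  choose W hW hmax using exists_greatest_weightsLE ρ p w
  have hGT : ∀ n, WeightsGT ρ p w n (W n) := fun n =>
    weightsGT_of_forall h1 h2 (W n) (hW n).isStable fun N₁ m hle hs hpure hm =>
      hmax n N₁ (.step (hW n) hle hs hpure hm)
  have hmono : Monotone W := fun m n hmn => hmax n _ ((hW m).mono hmn)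
  refine ⟨W, hmono, ?_, ?_, fun m => (hW m).isStable, fun n => ?_⟩
  · obtain ⟨n, hn⟩ := exists_weightsGT h1 ⊥ isStable_bot
    exact ⟨n, le_bot_iff.mp ((hW n).le_of_weightsGT hp hn)⟩
  · obtain ⟨n, hn⟩ := exists_weightsLE_top h1
    exact ⟨n, top_le_iff.mp (hmax n _ hn)⟩
  -- Purity of `W n / W (n - 1)` is obtained by descending from `⊤` to `W (n - 1)` along a chain
  -- with layers of weight greater than `n - 1`. Layers of weight above `n` do not meet `W n`;
  -- layers of weight exactly `n` are glued by the equal-weight half of `HasSplitting`.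
  · have key : ∀ N : Submodule k V, WeightsGT ρ p w (n - 1) N →
        IsPure ρ p w n (W n ⊓ N) (W n) := by
      intro N hN
      induction hN with
      | top =>
        intro α β _ v hv
        rw [inf_top_eq]
        exact (W n).sub_mem ((hW n).isStable α v hv) ((W n).smul_mem _ hv)
      | @step N' N m h0 hle hs hpure hm ih =>
        rcases eq_or_lt_of_le (show n ≤ m by omega) with rfl | hlt
        · have := hpure.inf_right (hW n).isStable
          rw [inf_comm, inf_comm N] at this
          exact (h2 _ _ _ n n ((hW n).isStable.inf hs) ((hW n).isStable.inf h0.isStable)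
            (hW n).isStable (inf_le_inf_left _ hle) inf_le_left this ih le_rfl).1 rfl
        · exact ih.mono (le_inf inf_le_left ((hW n).inf_le hp h0.isStable hpure hlt)) le_rfl
    exact (key _ (hGT (n - 1))).mono inf_le_right le_rfl

end Pure

/-! ### The part that descends to `R` and its weight decomposition -/

section PurePart

variable {k : Type u} [Field k] {A O : Type*} [CommRing A] [HopfAlgebra k A]
  [CommRing O] [HopfAlgebra k O] {V : Type*} [AddCommGroup V] [Module k V]

/-- The counit takes the value `1` on every `T m`, so it is the formal sum of all coefficient
functionals; only finitely many of them see `y`. -/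
lemma exists_finset_slice_counit (y : V ⊗[k] k[T;T⁻¹]) :
    ∃ s : Finset ℤ, slice V counit y = ∑ m ∈ s, slice V (coeffT k m) y := by
  classical
  let b := laurentBasis k
  have hb : ∀ m, b m = T m := fun m => rfl
  let e := TensorProduct.equivFinsuppOfBasisRight (M := V) b
  have h1 : ∀ m, e y m = slice V (coeffT k m) y := fun m => by
    rw [TensorProduct.equivFinsuppOfBasisRight_apply]
    rfl
  refine ⟨(e y).support, ?_⟩
  have h2 := TensorProduct.equivFinsuppOfBasisRight_symm_apply b (e y)
  rw [LinearEquiv.symm_apply_apply] at h2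
  conv_lhs => rw [h2]
  rw [Finsupp.sum, map_sum]
  refine Finset.sum_congr rfl fun m _ => ?_
  rw [slice_tmul, hb, counit_T, one_smul, h1]

lemma conv_apply_T (β γ : k[T;T⁻¹] →ₗ[k] k) (n : ℤ) :
    conv β γ (T n) = β (T n) * γ (T n) := by
  simp [conv]

/-- Hence `coeffT k m` acts as the projection onto the weight `m` part. -/
lemma conv_coeffT (β : k[T;T⁻¹] →ₗ[k] k) (m : ℤ) :
    conv β (coeffT k m) = β (T m) • coeffT k m := by
  apply laurent_hom_ext
  intro n
  rw [conv_apply_T, LinearMap.smul_apply, coeffT_T]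
  split_ifs with h
  · simp [h]
  · simp

/-- The cocharacter `w : 𝔾ₘ → R` has central image. -/
def IsCentral (w : O →ₐc[k] k[T;T⁻¹]) : Prop :=
  ∀ f : O, (w : O →ₗ[k] k[T;T⁻¹]).rTensor O (comul (R := k) f) =
    TensorProduct.comm k O k[T;T⁻¹] ((w : O →ₗ[k] k[T;T⁻¹]).lTensor O (comul (R := k) f))

lemma IsCentral.conv_comm {w : O →ₐc[k] k[T;T⁻¹]} (h : IsCentral w) (β : k[T;T⁻¹] →ₗ[k] k)
    (γ : O →ₗ[k] k) : conv (β ∘ₗ (w : O →ₗ[k] k[T;T⁻¹])) γ =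
      conv γ (β ∘ₗ (w : O →ₗ[k] k[T;T⁻¹])) := by
  ext f
  have e1 : ∀ z : O ⊗[k] O, dualMul (β ∘ₗ (w : O →ₗ[k] k[T;T⁻¹])) γ z =
      dualMul β γ ((w : O →ₗ[k] k[T;T⁻¹]).rTensor O z) := by
    intro z
    induction z with
    | zero => simp
    | add x y hx hy => simp only [map_add, hx, hy]
    | tmul a b => simp
  have e2 : ∀ z : O ⊗[k] O, dualMul γ (β ∘ₗ (w : O →ₗ[k] k[T;T⁻¹])) z =
      dualMul β γ (TensorProduct.comm k O k[T;T⁻¹] ((w : O →ₗ[k] k[T;T⁻¹]).lTensor O z)) := by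
    intro z
    induction z with
    | zero => simp
    | add x y hx hy => simp only [map_add, hx, hy]
    | tmul a b => simp [mul_comm]
  simp only [conv, LinearMap.comp_apply]
  rw [e1, e2, h]

/-- The largest submodule on which the action factors through `R` and is pure of weight `m`. -/
def purePart (ρ : GModule k A V) (p : O →ₐc[k] A) (w : O →ₐc[k] k[T;T⁻¹]) (m : ℤ) :
    Submodule k V where
  carrier := {x | ∀ α β, Compat p w α β → ρ.op α x = β (T m) • x}
  add_mem' hx hy α β hc := by rw [map_add, hx α β hc, hy α β hc, smul_add]
  zero_mem' α β _ := by simp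
  smul_mem' c x hx α β hc := by rw [map_smul, hx α β hc, smul_comm]

/-- The largest submodule on which the action factors through `R`. -/
def descentPart (ρ : GModule k A V) (p : O →ₐc[k] A) : Submodule k V where
  carrier := {x | ∀ α : A →ₗ[k] k, α ∘ₗ (p : O →ₗ[k] A) = 0 → ρ.op α x = 0}
  add_mem' hx hy α hc := by rw [map_add, hx α hc, hy α hc, add_zero]
  zero_mem' α _ := by simp
  smul_mem' c x hx α hc := by rw [map_smul, hx α hc, smul_zero]

variable {ρ : GModule k A V} {p : O →ₐc[k] A} {w : O →ₐc[k] k[T;T⁻¹]}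

lemma purePart_le_descentPart (m : ℤ) : purePart ρ p w m ≤ descentPart ρ p := by
  intro x hx α hα
  have : Compat p w α 0 := by rw [Compat, hα, LinearMap.zero_comp]
  rw [hx α 0 this, LinearMap.zero_apply, zero_smul]

lemma op_eq_of_mem_descentPart {x : V} (hx : x ∈ descentPart ρ p) {α γ : A →ₗ[k] k}
    (h : α ∘ₗ (p : O →ₗ[k] A) = γ ∘ₗ (p : O →ₗ[k] A)) : ρ.op α x = ρ.op γ x := by
  rw [← sub_eq_zero, ← ρ.op_sub]
  exact hx _ (by rw [LinearMap.sub_comp, h, sub_self])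

/-- On vectors where the action factors through `R`, only pullbacks of functionals to `O(R)` matter.
There, functionals coming from `w` commute with all others by centrality. -/
lemma isStable_purePart (hw : IsCentral w) (m : ℤ) : IsStable ρ (purePart ρ p w m) := by
  intro γ x hx α β hc
  have hx' := purePart_le_descentPart m hx
  rw [ρ.op_op, ← map_smul, ← hx α β hc, ρ.op_op]
  apply op_eq_of_mem_descentPart hx'
  rw [conv_comp, conv_comp, hc, hw.conv_comm]

lemma isPure_purePart (m : ℤ) : IsPure ρ p w m ⊥ (purePart ρ p w m) := by
  intro α β hc x hx
  rw [hx α β hc, sub_self]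
  exact Submodule.zero_mem _

lemma op_mem_purePart {x : V} (hx : x ∈ descentPart ρ p) {m : ℤ} {γ : A →ₗ[k] k}
    (hγ : Compat p w γ (coeffT k m)) : ρ.op γ x ∈ purePart ρ p w m := by
  intro α β hc
  rw [ρ.op_op, ← ρ.op_smul]
  apply op_eq_of_mem_descentPart hx
  rw [conv_comp, hc, hγ, ← conv_comp, conv_coeffT, LinearMap.smul_comp, LinearMap.smul_comp, hγ]

/-- The coaction on `x` comes from `V ⊗ O(R)`; restricting along `w` and expanding the counit writes
`x` as the finite sum of its weight components. -/
lemma descentPart_le_iSup (hp : Function.Injective p) :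
    descentPart ρ p ≤ ⨆ m, purePart ρ p w m := by
  intro x hx
  obtain ⟨z, hz⟩ := mem_range_lTensor (f := (p : O →ₗ[k] A)) hp (x := ρ.coact x) hx
  have h1 : ∀ α β, Compat p w α β →
      ρ.op α x = slice V β ((w : O →ₗ[k] k[T;T⁻¹]).lTensor V z) := by
    intro α β hc
    rw [ρ.op_apply, ← hz, slice_lTensor, hc, slice_lTensor]
  have h2 : Compat p w counit counit := by
    ext o
    exact (CoalgHomClass.counit_comp_apply p o).trans (CoalgHomClass.counit_comp_apply w o).symm
  obtain ⟨s, hs⟩ := exists_finset_slice_counit ((w : O →ₗ[k] k[T;T⁻¹]).lTensor V z)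
  rw [← h1 _ _ h2, ρ.op_counit] at hs
  rw [hs]
  refine Submodule.sum_mem _ fun m _ => Submodule.mem_iSup_of_mem m ?_
  obtain ⟨γ, hγ⟩ := exists_compat hp w (coeffT k m)
  rw [← h1 γ _ hγ]
  exact op_mem_purePart hx hγ

lemma exists_purePart_ne_bot (hp : Function.Injective p) (h : descentPart ρ p ≠ ⊥) :
    ∃ m, purePart ρ p w m ≠ ⊥ := by
  by_contra! hm
  apply h
  rw [eq_bot_iff]
  refine (descentPart_le_iSup (w := w) hp).trans ?_
  simp [hm]

/-- `HasPureSub` follows if every nonzero quotient has a nonzero vector on which the action factors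
through `R`. -/
lemma hasPureSub_of_descentPart (hp : Function.Injective p) (hw : IsCentral w)
    (h : ∀ (N : Submodule k V), N ≠ ⊤ → ∀ σ : GModule k A (V ⧸ N), descentPart σ p ≠ ⊥) :
    HasPureSub ρ p w := by
  intro N hN hne
  obtain ⟨σ, hσ⟩ := hN.exists_quot
  obtain ⟨m, hm⟩ := exists_purePart_ne_bot (w := w) hp (h N hne σ)
  refine ⟨(purePart σ p w m).comap N.mkQ, m, ?_, ?_, ?_⟩
  · refine lt_of_le_of_ne (Submodule.le_comap_mkQ N _) fun heq => hm ?_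
    rw [← Submodule.map_comap_eq_of_surjective N.mkQ_surjective (purePart σ p w m), ← heq]
    simp
  · intro α v hv
    rw [Submodule.mem_comap, ← hσ]
    exact isStable_purePart hw m α _ hv
  · intro α β hc v hv
    have := hv α β hc
    rwa [hσ, ← map_smul, ← sub_eq_zero, ← map_sub, Submodule.mkQ_apply,
      Submodule.Quotient.mk_eq_zero] at this

/-- The module is the sum of its pure parts. Parts of weight other than `b` lie in `Y`, and parts of
weight other than `a` meet `Y` trivially. For `a = b` only one weight survives; otherwise the weight
`b` part is a complement of `Y`. -/
lemma splitting_of_descentPart (hp : Function.Injective p) (hw : IsCentral w)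
    (h : descentPart ρ p = ⊤) {Y : Submodule k V} {a b : ℤ} (h1 : IsPure ρ p w a ⊥ Y)
    (h2 : IsPure ρ p w b Y ⊤) :
    (a = b → IsPure ρ p w a ⊥ ⊤) ∧
    (b < a → ∃ N, IsStable ρ N ∧ N ⊓ Y = ⊥ ∧ N ⊔ Y = ⊤) := by
  have htop : (⊤ : Submodule k V) ≤ ⨆ m, purePart ρ p w m := h ▸ descentPart_le_iSup hp
  have hY : ∀ m, m ≠ b → purePart ρ p w m ≤ Y := fun m hm x hx =>
    mem_of_pure_of_pure hp hm
      (fun α β hc => by rw [hx α β hc, sub_self]; exact Y.zero_mem)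
      (fun α β hc => h2 α β hc x trivial)
  have h0 : ∀ m, m ≠ a → purePart ρ p w m ⊓ Y = ⊥ := fun m hm => by
    rw [eq_bot_iff]
    intro x hx
    exact mem_of_pure_of_pure hp hm
      (fun α β hc => by rw [hx.1 α β hc, sub_self]; exact Submodule.zero_mem _)
      (fun α β hc => h1 α β hc x hx.2)
  constructor
  · rintro rfl
    refine (isPure_purePart a).mono le_rfl (htop.trans (iSup_le fun m => ?_))
    by_cases hm : m = a
    · rw [hm]
    · rw [← inf_eq_left.mpr (hY m hm), h0 m hm]
      exact bot_le
  · intro hlt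
    refine ⟨purePart ρ p w b, isStable_purePart hw b, h0 b hlt.ne, ?_⟩
    refine top_le_iff.mp (htop.trans (iSup_le fun m => ?_))
    by_cases hm : m = b
    · rw [hm]
      exact le_sup_left
    · exact (hY m hm).trans le_sup_right

end PurePart

/-! ### Matrix coefficients -/

section Coefficients

variable {k : Type u} [Field k] {C D : Type*} [AddCommGroup C] [Module k C]
  [AddCommGroup D] [Module k D]

lemma apply_slice (α : C →ₗ[k] k) (β : D →ₗ[k] k) (z : C ⊗[k] D) :
    α (slice C β z) = dualMul α β z := by
  induction z with
  | zero => simp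
  | add x y hx hy => simp only [map_add, hx, hy]
  | tmul a b => simp [mul_comm]

lemma eq_of_forall_dual {c c' : C} (h : ∀ α : C →ₗ[k] k, α c = α c') : c = c' := by
  rw [← sub_eq_zero, ← Module.forall_dual_apply_eq_zero_iff k]
  intro α
  rw [map_sub, h, sub_self]

lemma ext_dualMul {z z' : C ⊗[k] D}
    (h : ∀ (α : C →ₗ[k] k) (β : D →ₗ[k] k), dualMul α β z = dualMul α β z') : z = z' :=
  ext_slice fun β => eq_of_forall_dual fun α => by rw [apply_slice, apply_slice, h]

variable {A B O : Type*} [CommRing A] [HopfAlgebra k A]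
  [CommRing B] [HopfAlgebra k B] [CommRing O] [HopfAlgebra k O]
  {V V' : Type*} [AddCommGroup V] [Module k V] [AddCommGroup V'] [Module k V']

/-- The matrix coefficient `g ↦ l (g v)`. -/
def coef (ρ : GModule k A V) (l : V →ₗ[k] k) (v : V) : A :=
  TensorProduct.lid k A (l.rTensor A (ρ.coact v))

lemma apply_coef (ρ : GModule k A V) (l : V →ₗ[k] k) (v : V) (α : A →ₗ[k] k) :
    α (coef ρ l v) = l (ρ.op α v) := by
  simp only [coef, GModule.op_apply]
  induction ρ.coact v with
  | zero => simp
  | add x y hx hy => simp only [map_add, hx, hy]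
  | tmul a b => simp [mul_comm]

lemma coef_res (ρ : GModule k A V) (φ : A →ₐc[k] B) (l : V →ₗ[k] k) (v : V) :
    coef (ρ.res φ) l v = φ (coef ρ l v) := by
  apply eq_of_forall_dual (k := k)
  intro α
  rw [apply_coef, ρ.op_res, ← apply_coef]
  rfl

lemma comul_coef {ι : Type*} [Fintype ι] (ρ : GModule k A V) (e : Module.Basis ι k V)
    (l : V →ₗ[k] k) (v : V) :
    comul (R := k) (coef ρ l v) = ∑ i, coef ρ l (e i) ⊗ₜ[k] coef ρ (e.coord i) v := by
  apply ext_dualMul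
  intro α β
  have h1 : dualMul α β (comul (R := k) (coef ρ l v)) = conv α β (coef ρ l v) := rfl
  rw [h1, apply_coef, ← ρ.op_op, map_sum]
  conv_lhs => rw [← e.sum_repr (ρ.op β v)]
  simp only [map_sum, map_smul, dualMul_tmul, apply_coef, Module.Basis.coord_apply, smul_eq_mul,
    mul_comm]

lemma counit_coef (ρ : GModule k A V) (l : V →ₗ[k] k) (v : V) :
    counit (R := k) (coef ρ l v) = l v := by
  rw [apply_coef, ρ.op_counit]

/-- Transport of a `G`-module structure along a linear equivalence. -/
lemma GModule.exists_transport (ρ : GModule k A V) (e : V ≃ₗ[k] V') :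
    ∃ σ : GModule k A V', ∀ α v, σ.op α (e v) = e (ρ.op α v) := by
  let c : V' →ₗ[k] V' ⊗[k] A :=
    (e : V →ₗ[k] V').rTensor A ∘ₗ ρ.coact ∘ₗ (e.symm : V' →ₗ[k] V)
  have key : ∀ (α : A →ₗ[k] k) (v : V'), slice V' α (c v) = e (ρ.op α (e.symm v)) :=
    fun α v => slice_rTensor _ _ _
  refine ⟨GModule.ofOp c (fun α β v => ?_) (fun v => ?_), fun α v => ?_⟩
  · rw [key, key, key, e.symm_apply_apply, ρ.op_op]
  · rw [key, ρ.op_counit, e.apply_symm_apply]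
  · refine (key α (e v)).trans ?_
    rw [e.symm_apply_apply]

end Coefficients

/-! ### Descent along a quotient map -/

section Descent

variable {k : Type u} [Field k] {O B : Type*} [CommRing O] [HopfAlgebra k O]
  [CommRing B] [HopfAlgebra k B]

/-- The comorphism of the inclusion of the kernel of the homomorphism with comorphism `q`. -/
def kernelMk (q : O →ₐc[k] B) : B →ₐc[k] KernelRing q :=
  Bialgebra.Quotient.mkBialgHom (kernelIdeal q)

lemma kernelMk_apply (q : O →ₐc[k] B) (b : B) :
    kernelMk q b = Ideal.Quotient.mk (kernelIdeal q) b := rfl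

lemma antipode_conv {D : Type*} [CommRing D] [Algebra k D] (f : B →ₐ[k] D) :
    (WithConv.toConv (f.comp (antipodeAlgHom k B)) * WithConv.toConv f).ofConv =
      (1 : WithConv (B →ₐ[k] D)).ofConv := by
  have h := AlgHom.comp_convMul_distrib f (.toConv (antipodeAlgHom k B))
    (.toConv (AlgHom.id k B))
  rw [AlgHom.antipode_id_cancel] at h
  refine h.symm.trans ?_
  ext b
  exact f.commutes _

lemma conv_antipode {D : Type*} [CommRing D] [Algebra k D] (f : B →ₐ[k] D) :
    WithConv.toConv f * WithConv.toConv (f.comp (antipodeAlgHom k B)) = 1 := by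
  have h := AlgHom.comp_convMul_distrib f (.toConv (AlgHom.id k B))
    (.toConv (antipodeAlgHom k B))
  have h2 : (WithConv.toConv (AlgHom.id k B)) * .toConv (antipodeAlgHom k B) = 1 :=
    mul_inv_cancel (WithConv.toConv (AlgHom.id k B))
  rw [h2] at h
  apply WithConv.ofConv_injective
  refine h.symm.trans ?_
  ext b
  exact f.commutes _

/-- Two `D`-valued points `i₁`, `i₂` of `G` with the same image in `R` satisfy `i₂ = i₁ u` with `u =
i₁⁻¹ i₂` a point of the kernel. A function invariant under right translation by the kernel takes the
same value at both. -/
lemma eq_of_kernel_invariant {D : Type*} [CommRing D] [Algebra k D] (q : O →ₐc[k] B)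
    (i₁ i₂ : B →ₐ[k] D) (h : ∀ o, i₁ (q o) = i₂ (q o)) {b : B}
    (hb : (kernelMk q : B →ₗ[k] KernelRing q).lTensor B (comul (R := k) b) =
      b ⊗ₜ[k] (1 : KernelRing q)) : i₁ b = i₂ b := by
  let j₁ : WithConv (B →ₐ[k] D) := .toConv i₁
  let j₁' : WithConv (B →ₐ[k] D) := .toConv (i₁.comp (antipodeAlgHom k B))
  let j₂ : WithConv (B →ₐ[k] D) := .toConv i₂
  -- The point `i₁⁻¹ i₂` becomes trivial in `R`, so it factors through the coordinate ring of the
  -- kernel as `hbar`.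
  have hu : ∀ o, (j₁' * j₂).ofConv (q o) = algebraMap k D (counit (R := k) o) := by
    intro o
    have e1 : (j₁' * j₂).ofConv.comp (q : O →ₐ[k] B) =
        (1 : WithConv (O →ₐ[k] D)).ofConv := by
      refine (AlgHom.convMul_comp_bialgHom_distrib j₁' j₂ q).trans ?_
      refine Eq.trans ?_ (antipode_conv (i₁.comp (q : O →ₐ[k] B)))
      congr 3
      · ext o
        change i₁ (antipode k (q o)) = i₁ (q (antipode k o))
        rw [antipode_bialgHom]
      · ext o
        exact (h o).symm
    exact DFunLike.congr_fun e1 o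
  let hbar : KernelRing q →ₐ[k] D := Ideal.Quotient.liftₐ (kernelIdeal q) (j₁' * j₂).ofConv (by
    have : kernelIdeal q ≤ RingHom.ker (j₁' * j₂).ofConv := by
      refine Ideal.map_le_iff_le_comap.mpr fun o ho => ?_
      have ho' : counit (R := k) o = 0 := ho
      change (j₁' * j₂).ofConv (q o) = 0
      rw [hu, ho', map_zero]
    exact fun a ha => this ha)
  have e2 : (j₁ * (j₁' * j₂)) b = i₁ b := by
    rw [AlgHom.convMul_apply]
    have e3 : ∀ z : B ⊗[k] B, Algebra.TensorProduct.lift j₁.ofConv (j₁' * j₂).ofConv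
        (fun _ _ => Commute.all _ _) z = Algebra.TensorProduct.lift i₁ hbar
          (fun _ _ => Commute.all _ _)
          ((kernelMk q : B →ₗ[k] KernelRing q).lTensor B z) := by
      intro z
      induction z with
      | zero => simp
      | add x y hx hy => simp only [map_add, hx, hy]
      | tmul a b =>
        simp only [Algebra.TensorProduct.lift_tmul, LinearMap.lTensor_tmul]
        rfl
    have e4 := e3 (comul (R := k) b)
    rw [hb] at e4
    simp only [Algebra.TensorProduct.lift_tmul, map_one, mul_one] at e4
    rw [← e4]
  rw [← e2, ← mul_assoc, conv_antipode, one_mul]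

/-- By faithfully flat descent, `O(R)` is the equalizer of the two maps `B → B ⊗ B` over `O(R)`.
These are two points of `G` with the same image in `R`, so they agree on invariant functions. -/
lemma mem_range_of_kernel_invariant {q : O →ₐc[k] B}
    (hq : ((q : O →ₐ[k] B) : O →+* B).FaithfullyFlat) {b : B}
    (hb : (kernelMk q : B →ₗ[k] KernelRing q).lTensor B (comul (R := k) b) =
      b ⊗ₜ[k] (1 : KernelRing q)) : ∃ o, q o = b := by
  algebraize [((q : O →ₐ[k] B) : O →+* B)]
  have : IsScalarTower k O B := .of_algebraMap_eq fun c => ((q : O →ₐ[k] B).commutes c).symm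
  have h1 := Algebra.IsEffective.of_faithfullyFlat O B
  refine (h1 b).mp ?_
  rw [Algebra.TensorProduct.includeLeftSubRight_apply, sub_eq_zero]
  refine eq_of_kernel_invariant q (Algebra.TensorProduct.includeLeft : B →ₐ[k] B ⊗[O] B)
    ((Algebra.TensorProduct.includeRight : B →ₐ[O] B ⊗[O] B).restrictScalars k) (fun o => ?_) hb
  change (algebraMap O B o) ⊗ₜ[O] (1 : B) = 1 ⊗ₜ[O] algebraMap O B o
  rw [Algebra.algebraMap_eq_smul_one, TensorProduct.smul_tmul]

variable {V : Type*} [AddCommGroup V] [Module k V]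

/-- Vectors fixed by the kernel of `G → R` lie in a module over `R`. -/
lemma mem_descentPart_of_fixed {q : O →ₐc[k] B}
    (hq : ((q : O →ₐ[k] B) : O →+* B).FaithfullyFlat) (ρ : GModule k B V) {x : V}
    (hx : ∀ γ : KernelRing q →ₗ[k] k, (ρ.res (kernelMk q)).op γ x = γ 1 • x) :
    x ∈ descentPart ρ q := by
  intro α hα
  rw [← Module.forall_dual_apply_eq_zero_iff k]
  intro l
  rw [← apply_coef]
  -- Since `U` fixes `x`, the coefficient `g ↦ l (g x)` is invariant under right translation by `U`,
  -- hence is a function on `R`.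
  obtain ⟨o, ho⟩ : ∃ o, q o = coef ρ l x := by
    apply mem_range_of_kernel_invariant hq
    apply ext_dualMul
    intro β γ
    have e : ∀ z : B ⊗[k] B, dualMul β γ ((kernelMk q : B →ₗ[k] KernelRing q).lTensor B z) =
        dualMul β (γ ∘ₗ (kernelMk q : B →ₗ[k] KernelRing q)) z := by
      intro z
      induction z with
      | zero => simp
      | add x y hx hy => simp only [map_add, hx, hy]
      | tmul a b => simp
    rw [e]
    change conv β (γ ∘ₗ (kernelMk q : B →ₗ[k] KernelRing q)) (coef ρ l x) = _
    rw [apply_coef, ← ρ.op_op, ← ρ.op_res, hx, dualMul_tmul, apply_coef, map_smul, map_smul,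
      smul_eq_mul, mul_comm]
  rw [← ho]
  exact LinearMap.congr_fun hα o

lemma descentPart_ne_bot [Module.Finite k V] [Nontrivial V] {q : O →ₐc[k] B}
    (hq : ((q : O →ₐ[k] B) : O →+* B).FaithfullyFlat) (hU : IsUnipotent k (KernelRing q))
    (ρ : GModule k B V) : descentPart ρ q ≠ ⊥ := by
  obtain ⟨n, hn⟩ : ∃ n, Module.finrank k V = n + 1 :=
    Nat.exists_eq_succ_of_ne_zero Module.finrank_pos.ne'
  let e : V ≃ₗ[k] (Fin (n + 1) → k) := (Module.finBasisOfFinrankEq k V hn).equivFun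
  obtain ⟨σ, hσ⟩ := (ρ.res (kernelMk q)).exists_transport e
  obtain ⟨x, hx, hfix⟩ := hU n σ
  refine fun hbot => hx ?_
  have : e.symm x ∈ descentPart ρ q := by
    apply mem_descentPart_of_fixed hq
    intro γ
    apply e.injective
    rw [← hσ, e.apply_symm_apply, σ.op_apply, hfix, slice_tmul, map_smul, e.apply_symm_apply]
  rw [hbot, Submodule.mem_bot] at this
  simpa using this

end Descent

/-! ### Extensions of pure modules in the wrong order -/

section Negativity

variable {k : Type u} [Field k] {O B A : Type*} [CommRing O] [HopfAlgebra k O]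
  [CommRing B] [HopfAlgebra k B] [CommRing A] [HopfAlgebra k A]
  {V P : Type*} [AddCommGroup V] [Module k V] [AddCommGroup P] [Module k P]

/-- A weight vector of a module gives a weight vector of the dual module. -/
lemma eq_zero_of_dualWeightSpace_eq_bot (τ : GModule k O P) (w : O →ₐc[k] k[T;T⁻¹]) {m : ℤ}
    (h : dualWeightSpace τ w m = ⊥) {f : P}
    (hf : (τ.res w).coact f = f ⊗ₜ[k] (T (-m) : k[T;T⁻¹])) : f = 0 := by
  rw [← Module.forall_dual_apply_eq_zero_iff k]
  intro l
  -- `l` composed with the projection onto weight `-m`: a functional of weight `m` in the dual that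
  -- agrees with `l` at `f`.
  let χ : Module.Dual k P := l ∘ₗ (τ.res w).op (coeffT k (-m))
  have hχ : χ ∈ dualWeightSpace τ w m := by
    intro f'
    apply ext_slice
    intro β
    rw [slice_rTensor, ← GModule.op_apply, slice_tmul]
    change l ((τ.res w).op _ ((τ.res w).op β f')) = β _ • l ((τ.res w).op _ f')
    have e : conv (coeffT k (-m)) β = β (T (-m)) • coeffT k (-m) := by
      apply laurent_hom_ext
      intro n
      rw [conv_apply_T, LinearMap.smul_apply, coeffT_T]
      split_ifs with h
      · simp [h]
      · simp
    rw [GModule.op_op, e, GModule.op_smul, map_smul]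
  rw [h, Submodule.mem_bot] at hχ
  have h2 : χ f = l f := by
    change l ((τ.res w).op _ f) = _
    rw [GModule.op_apply, hf, slice_tmul, coeffT_T, if_pos rfl, one_smul]
  rw [← h2, hχ, LinearMap.zero_apply]

/-- Compatible pairs with `β = 0` show that `b` comes from `O(R)`; the other pairs then determine
its restriction along `w`. -/
lemma exists_coef_eq {q : O →ₐc[k] B} {w : O →ₐc[k] k[T;T⁻¹]} (hq : Function.Injective q)
    {b : B} {c : k} {m : ℤ} (h : ∀ α β, Compat q w α β → α b = c * β (T m)) :
    ∃ o, q o = b ∧ w o = c • (T m : k[T;T⁻¹]) := by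
  obtain ⟨r, hr⟩ := (q : O →ₗ[k] B).exists_leftInverse_of_injective (LinearMap.ker_eq_bot.mpr hq)
  have h1 : q (r b) = b := by
    apply eq_of_forall_dual (k := k)
    intro α
    rw [← sub_eq_zero, ← map_sub, ← neg_eq_zero, ← map_neg, neg_sub]
    have hc : Compat q w (α - α ∘ₗ (q : O →ₗ[k] B) ∘ₗ r) 0 := by
      rw [Compat, LinearMap.sub_comp, LinearMap.comp_assoc, LinearMap.comp_assoc, hr,
        LinearMap.comp_id, sub_self, LinearMap.zero_comp]
    have := h _ _ hc
    rw [LinearMap.zero_apply, mul_zero] at this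
    rw [map_sub]
    exact this
  refine ⟨r b, h1, ?_⟩
  apply eq_of_forall_dual (k := k)
  intro β
  obtain ⟨α, hα⟩ := exists_compat hq w β
  rw [← hα.apply, h1, h α β hα, map_smul, smul_eq_mul]

lemma conjCoact_coef {ι : Type*} [Fintype ι] (ρ : GModule k B V) (e : Module.Basis ι k V)
    (l : V →ₗ[k] k) (v : V) :
    conjCoact k B (coef ρ l v) = ∑ i, ∑ j, coef ρ (e.coord i) (e j) ⊗ₜ[k]
      (antipode k (coef ρ l (e i)) * coef ρ (e.coord j) v) := by
  simp only [conjCoact, LinearMap.comp_apply, comul_coef ρ e, map_sum, LinearMap.lTensor_tmul,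
    TensorProduct.tmul_sum, LinearEquiv.coe_coe, TensorProduct.leftComm_tmul,
    LinearMap.rTensor_tmul, LinearMap.mul'_apply]

lemma conjCoact_one : conjCoact k B 1 = 1 ⊗ₜ[k] (1 : B) := by
  simp [conjCoact, Algebra.TensorProduct.one_def]

lemma sum_antipode_coef {ι : Type*} [Fintype ι] (ρ : GModule k B V) (e : Module.Basis ι k V)
    (l : V →ₗ[k] k) (v : V) :
    ∑ i, antipode k (coef ρ l (e i)) * coef ρ (e.coord i) v = algebraMap k B (l v) := by
  have h := HopfAlgebra.mul_antipode_rTensor_comul_apply (R := k) (coef ρ l v)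
  rw [counit_coef] at h
  rw [← h, comul_coef ρ e]
  simp

/-- The deviation of a matrix coefficient of a module from that of the trivial module. -/
def coefDev (σ : GModule k B V) (l : V →ₗ[k] k) (v : V) : B := coef σ l v - algebraMap k B (l v)

lemma apply_coefDev (σ : GModule k B V) (l : V →ₗ[k] k) (v : V) (α : B →ₗ[k] k) :
    α (coefDev σ l v) = l (σ.op α v - α 1 • v) := by
  rw [coefDev, map_sub, apply_coef, Algebra.algebraMap_eq_smul_one, map_smul, map_sub, map_smul,
    smul_eq_mul, smul_eq_mul, mul_comm]

/-- On `V` one has `(g - 1)(h - 1) = 0`, because `h - 1` maps `V` into `Y`, where `g` acts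
trivially. Thus `gh - 1 = (g - 1) + (h - 1)`, and the entries of `g - 1` are additive characters. -/
lemma coefDev_mem_homGa {σ : GModule k B V} {Y : Submodule k V}
    (h1 : ∀ (α : B →ₗ[k] k), ∀ y ∈ Y, σ.op α y = α 1 • y)
    (h2 : ∀ (α : B →ₗ[k] k) (x : V), σ.op α x - α 1 • x ∈ Y) (l : V →ₗ[k] k) (v : V) :
    coefDev σ l v ∈ homGa k B := by
  apply ext_dualMul
  intro α β
  change conv α β (coefDev σ l v) = dualMul α β (coefDev σ l v ⊗ₜ 1 + 1 ⊗ₜ coefDev σ l v)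
  rw [apply_coefDev, map_add, dualMul_tmul, dualMul_tmul, apply_coefDev, apply_coefDev,
    ← σ.op_op]
  have e : conv α β 1 = α 1 * β 1 := by
    simp [conv, Algebra.TensorProduct.one_def]
  have h3 := h1 α _ (h2 β v)
  rw [map_sub, map_smul] at h3
  have h4 : σ.op α (σ.op β v) = α 1 • (σ.op β v - β 1 • v) + β 1 • σ.op α v := by
    rw [← h3, sub_add_cancel]
  rw [e, h4]
  simp only [map_add, map_sub, map_smul, smul_eq_mul]
  ring

lemma coefDev_eq_sum {ι : Type*} [Fintype ι] (σ : GModule k B V) (e : Module.Basis ι k V)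
    (l : V →ₗ[k] k) (v : V) :
    coefDev σ l v = ∑ i, ∑ j, (l (e i) * e.coord j v) • coefDev σ (e.coord i) (e j) := by
  apply eq_of_forall_dual (k := k)
  intro α
  simp only [map_sum, map_smul, apply_coefDev, smul_eq_mul]
  let D : V →ₗ[k] V := σ.op α - α 1 • LinearMap.id
  have hD : ∀ x, σ.op α x - α 1 • x = D x := fun x => rfl
  simp only [hD]
  have h1 : ∀ x, l (D x) = ∑ i, l (e i) * e.coord i (D x) := by
    intro x
    conv_lhs => rw [← e.sum_repr (D x)]
    simp only [map_sum, map_smul, smul_eq_mul, Module.Basis.coord_apply, mul_comm]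
  have h2 : ∀ i, e.coord i (D v) = ∑ j, e.coord j v * e.coord i (D (e j)) := by
    intro i
    conv_lhs => rw [← e.sum_repr v]
    simp only [map_sum, map_smul, smul_eq_mul, Module.Basis.coord_apply]
  rw [h1]
  refine Finset.sum_congr rfl fun i _ => ?_
  rw [h2, Finset.mul_sum]
  refine Finset.sum_congr rfl fun j _ => ?_
  ring

lemma coefDev_kernelMk (q : O →ₐc[k] B) (ρ : GModule k B V) (l : V →ₗ[k] k) (v : V) :
    coefDev (ρ.res (kernelMk q)) l v =
      Ideal.Quotient.mk (kernelIdeal q) (coef ρ l v - algebraMap k B (l v)) := by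
  rw [coefDev, coef_res, map_sub]
  rfl

/-- The conjugation action on the deviations of the matrix coefficients. -/
lemma rTensor_conjCoact_coef {ι : Type*} [Fintype ι] (q : O →ₐc[k] B) (ρ : GModule k B V)
    (e : Module.Basis ι k V) (l : V →ₗ[k] k) (v : V) :
    (Ideal.Quotient.mkₐ k (kernelIdeal q)).toLinearMap.rTensor B
        (conjCoact k B (coef ρ l v - algebraMap k B (l v))) =
      ∑ i, ∑ j, coefDev (ρ.res (kernelMk q)) (e.coord i) (e j) ⊗ₜ[k]
        (antipode k (coef ρ l (e i)) * coef ρ (e.coord j) v) := by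
  classical
  have h0 : ∀ i j, (Ideal.Quotient.mkₐ k (kernelIdeal q)).toLinearMap (coef ρ (e.coord i) (e j)) =
      coefDev (ρ.res (kernelMk q)) (e.coord i) (e j) +
        (if i = j then (1 : k) else 0) • (1 : KernelRing q) := by
    intro i j
    rw [coefDev, coef_res, Algebra.algebraMap_eq_smul_one, Module.Basis.coord_apply,
      Module.Basis.repr_self, Finsupp.single_apply, sub_add]
    simp only [eq_comm (a := i), sub_self, sub_zero]
    rfl
  rw [map_sub, conjCoact_coef ρ e, Algebra.algebraMap_eq_smul_one, map_smul, conjCoact_one, map_sub]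
  simp only [map_sum, LinearMap.rTensor_tmul, h0, TensorProduct.add_tmul, Finset.sum_add_distrib]
  -- The identity part of the middle matrix contributes `S(b₁) b₂`, which is the constant `l v` by
  -- the antipode axiom and cancels the subtracted constant.
  rw [add_sub_assoc, add_eq_left, sub_eq_zero]
  simp only [ite_smul, one_smul, zero_smul, TensorProduct.ite_tmul,
    Finset.sum_ite_eq, Finset.mem_univ, if_true, ← TensorProduct.tmul_sum]
  rw [sum_antipode_coef ρ e, Algebra.algebraMap_eq_smul_one, TensorProduct.tmul_smul, map_smul,
    LinearMap.rTensor_tmul]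
  congr 2

/-- Extensions of pure modules of weight `b` by pure modules of weight `a ≥ b` are trivial on the
kernel of `G → R`. -/
lemma descentPart_eq_top [Module.Finite k V] {q : O →ₐc[k] B} {w : O →ₐc[k] k[T;T⁻¹]}
    (hq : IsNegWeightedAlg w q) {ρ : GModule k B V} {Y : Submodule k V} {a b : ℤ} (hab : b ≤ a)
    (hY : IsPure ρ q w a ⊥ Y) (hVY : IsPure ρ q w b Y ⊤) : descentPart ρ q = ⊤ := by
  have hinj : Function.Injective q := hq.faithfullyFlat.injective
  set σ := ρ.res (kernelMk q) with hσ
  -- The composite `U → G → R` is trivial, so a functional on `O(U)` restricts to `O(R)` as a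
  -- multiple of the counit. Purity therefore makes `U` act trivially on `Y` and on `V / Y`.
  have hcompat : ∀ γ : KernelRing q →ₗ[k] k,
      Compat q w (γ ∘ₗ (kernelMk q : B →ₗ[k] KernelRing q)) (γ 1 • counit) := by
    intro γ
    ext o
    change γ (kernelMk q (q o)) = γ 1 * counit (R := k) (w o)
    rw [kernelMk_apply, mk_kernelIdeal, CoalgHomClass.counit_comp_apply,
      Algebra.algebraMap_eq_smul_one, map_smul, smul_eq_mul, mul_comm]
  have h1 : ∀ (γ : KernelRing q →ₗ[k] k), ∀ y ∈ Y, σ.op γ y = γ 1 • y := by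
    intro γ y hy
    have := hY _ _ (hcompat γ) y hy
    rw [Submodule.mem_bot, sub_eq_zero, LinearMap.smul_apply, counit_T, smul_eq_mul,
      mul_one] at this
    rw [hσ, ρ.op_res, this]
  have h2 : ∀ (γ : KernelRing q →ₗ[k] k) (x : V), σ.op γ x - γ 1 • x ∈ Y := by
    intro γ x
    have := hVY _ _ (hcompat γ) x trivial
    rw [LinearMap.smul_apply, counit_T, smul_eq_mul, mul_one] at this
    rwa [hσ, ρ.op_res]
  have hmem := coefDev_mem_homGa h1 h2
  have z1 : ∀ l, ∀ y ∈ Y, coefDev σ l y = 0 := fun l y hy =>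
    eq_of_forall_dual (k := k) fun α => by
      rw [apply_coefDev, h1 α y hy, sub_self, map_zero, map_zero]
  have z2 : ∀ l : V →ₗ[k] k, (∀ y ∈ Y, l y = 0) → ∀ x, coefDev σ l x = 0 := fun l hl x =>
    eq_of_forall_dual (k := k) fun α => by
      rw [apply_coefDev, hl _ (h2 α x), map_zero]
  -- In a basis adapted to `Y`, only the block from `Z` to `Y` of the matrix of deviations can be
  -- nonzero.
  obtain ⟨Z, hYZ⟩ := Submodule.exists_isCompl Y
  let e := ((Module.finBasis k Y).prod (Module.finBasis k Z)).map
    (Submodule.prodEquivOfIsCompl Y Z hYZ)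
  have e1 : ∀ i, e (Sum.inl i) ∈ Y := by
    intro i
    simp [e]
  have e2 : ∀ j, ∀ y ∈ Y, e.coord (Sum.inr j) y = 0 := by
    intro j y hy
    have : (Submodule.prodEquivOfIsCompl Y Z hYZ).symm y = (⟨y, hy⟩, 0) :=
      Submodule.prodEquivOfIsCompl_symm_apply_left _ _ hYZ ⟨y, hy⟩
    simp [e, this]
  -- Coefficients of the two diagonal blocks are functions on `R`, with weights `a` (here) and `b`
  -- (next).
  have o1 : ∀ l, ∀ y ∈ Y, ∃ o, q o = coef ρ l y ∧ w o = l y • (T a : k[T;T⁻¹]) := by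
    intro l y hy
    apply exists_coef_eq hinj
    intro α β hc
    have := hY α β hc y hy
    rw [Submodule.mem_bot, sub_eq_zero] at this
    rw [apply_coef, this, map_smul, smul_eq_mul, mul_comm]
  have o2 : ∀ l : V →ₗ[k] k, (∀ y ∈ Y, l y = 0) → ∀ x,
      ∃ o, q o = coef ρ l x ∧ w o = l x • (T b : k[T;T⁻¹]) := by
    intro l hl x
    apply exists_coef_eq hinj
    intro α β hc
    have := hl _ (hVY α β hc x trivial)
    rw [map_sub, sub_eq_zero] at this
    rw [apply_coef, this, map_smul, smul_eq_mul, mul_comm]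
  obtain ⟨τ, hτ, hneg⟩ := hq.negative
  have hzero : ∀ l x, coefDev σ l x = 0 := by
    intro l x
    choose o ho how using fun i => o1 l (e (Sum.inl i)) (e1 i)
    choose o' ho' how' using fun j => o2 (e.coord (Sum.inr j)) (e2 j) x
    let F : (V →ₗ[k] k) → V → homGa k (KernelRing q) := fun l x => ⟨coefDev σ l x, hmem l x⟩
    have zF1 : ∀ l i, coefDev σ l (e (Sum.inl i)) = 0 := fun l i => z1 l _ (e1 i)
    have zF2 : ∀ j x, coefDev σ (e.coord (Sum.inr j)) x = 0 := fun j x => z2 _ (e2 j) x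
    have hco : τ.coact (F l x) = ∑ i, ∑ j,
        F (e.coord (Sum.inl i)) (e (Sum.inr j)) ⊗ₜ[k] (antipode k (o i) * o' j) := by
      -- The equation over `O(R)` is checked in `O(U) ⊗ B`, where `IsConjModule` expresses the
      -- action through conjugation of matrix coefficients.
      apply TensorProduct.map_injective_of_flat_flat _ (q : O →ₗ[k] B)
        (homGa k (KernelRing q)).injective_subtype hinj
      have hb : Ideal.Quotient.mk (kernelIdeal q) (coef ρ l x - algebraMap k B (l x)) ∈
          homGa k (KernelRing q) := coefDev_kernelMk q ρ l x ▸ hmem l x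
      have h := hτ _ hb
      have hF : F l x = ⟨_, hb⟩ := Subtype.ext (coefDev_kernelMk q ρ l x)
      rw [hF]
      refine h.symm.trans ?_
      rw [rTensor_conjCoact_coef q ρ e]
      simp only [Fintype.sum_sum_type, ← hσ, zF1, zF2, TensorProduct.zero_tmul,
        Finset.sum_const_zero, zero_add, add_zero, map_sum, TensorProduct.map_tmul]
      refine Finset.sum_congr rfl fun i _ => Finset.sum_congr rfl fun j _ => ?_
      rw [← ho, ← ho', antipode_bialgHom, ← map_mul]
      rfl
    -- The antipode inverts the weight `a` of the first factor and the second has weight `b`, so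
    -- conjugation acts with weight `b - a`.
    have hw : ∀ i j, w (antipode k (o i) * o' j) =
        (l (e (Sum.inl i)) * e.coord (Sum.inr j) x) • (T (-(a - b)) : k[T;T⁻¹]) := by
      intro i j
      rw [map_mul, ← antipode_bialgHom, how, how', map_smul, antipode_T, smul_mul_smul_comm,
        ← T_add]
      congr 2
      ring
    -- The same scalars occur here as in `hw`, so applying `w` to `hco` reassembles `F l x` as a
    -- single weight vector.
    have hFsum : F l x = ∑ i, ∑ j, (l (e (Sum.inl i)) * e.coord (Sum.inr j) x) •
        F (e.coord (Sum.inl i)) (e (Sum.inr j)) := by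
      apply Subtype.ext
      have h := coefDev_eq_sum σ e l x
      simp only [Fintype.sum_sum_type, zF1, zF2, smul_zero, Finset.sum_const_zero, zero_add,
        add_zero] at h
      simpa [F] using h
    have hres : (τ.res w).coact (F l x) = F l x ⊗ₜ[k] (T (-(a - b)) : k[T;T⁻¹]) := by
      change (w : O →ₗ[k] k[T;T⁻¹]).lTensor _ (τ.coact (F l x)) = _
      rw [hco]
      conv_rhs => rw [hFsum]
      simp only [map_sum, LinearMap.lTensor_tmul, TensorProduct.sum_tmul]
      refine Finset.sum_congr rfl fun i _ => Finset.sum_congr rfl fun j _ => ?_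
      refine (congrArg _ (hw i j)).trans ?_
      rw [TensorProduct.tmul_smul, TensorProduct.smul_tmul']
    exact congrArg Subtype.val
      (eq_zero_of_dualWeightSpace_eq_bot τ w (hneg (a - b) (by omega)) hres)
  rw [eq_top_iff]
  intro x _
  apply mem_descentPart_of_fixed hq.faithfullyFlat
  intro γ
  rw [← sub_eq_zero, ← Module.forall_dual_apply_eq_zero_iff k]
  intro l
  rw [← apply_coefDev, ← hσ, hzero, map_zero]

end Negativity

/-! ### Existence of the weight filtration -/

section Existence

variable {k : Type u} [Field k]

/-- Everything is transported to the subquotient `N₂ / N₀`, with `Y` the image of `N₁`, where the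
action factors through `R`. -/
lemma hasSplitting_of_isNegWeightedAlg {O B : Type*} [CommRing O] [HopfAlgebra k O]
    [CommRing B] [HopfAlgebra k B] {V : Type*} [AddCommGroup V] [Module k V] [Module.Finite k V]
    {q : O →ₐc[k] B} {w : O →ₐc[k] k[T;T⁻¹]} (hw : IsCentral w) (hq : IsNegWeightedAlg w q)
    (ρ : GModule k B V) : HasSplitting ρ q w := by
  intro N₀ N₁ N₂ a b hs0 hs1 hs2 h01 h12 hpa hpb hab
  obtain ⟨σ, hσ⟩ := hs2.exists_sub
  let N₀' := N₀.comap N₂.subtype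
  have hs0' : IsStable σ N₀' := fun α v hv => by
    rw [Submodule.mem_comap, Submodule.subtype_apply, hσ]
    exact hs0 α _ hv
  obtain ⟨τ, hτ⟩ := hs0'.exists_quot
  have mk0 : ∀ x : N₂, N₀'.mkQ x = 0 ↔ (x : V) ∈ N₀ := fun x =>
    Submodule.Quotient.mk_eq_zero N₀'
  let Y := (N₁.comap N₂.subtype).map N₀'.mkQ
  have hY : IsPure τ q w a ⊥ Y := by
    rintro α β hc _ ⟨x, hx, rfl⟩
    rw [hτ, ← map_smul, ← map_sub, Submodule.mem_bot, mk0, Submodule.coe_sub, hσ]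
    exact hpa α β hc x hx
  have hVY : IsPure τ q w b Y ⊤ := by
    intro α β hc x _
    obtain ⟨x, rfl⟩ := N₀'.mkQ_surjective x
    rw [hτ, ← map_smul, ← map_sub]
    refine Submodule.mem_map_of_mem ?_
    rw [Submodule.mem_comap, Submodule.subtype_apply, Submodule.coe_sub, hσ]
    exact hpb α β hc x x.2
  obtain ⟨heq, hlt⟩ := splitting_of_descentPart hq.faithfullyFlat.injective hw
    (descentPart_eq_top hq hab hY hVY) hY hVY
  constructor
  · intro h α β hc v hv
    have := heq h α β hc (N₀'.mkQ ⟨v, hv⟩) trivial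
    rwa [hτ, ← map_smul, ← map_sub, Submodule.mem_bot, mk0, Submodule.coe_sub, hσ] at this
  · intro h
    obtain ⟨M, hM, hinf, hsup⟩ := hlt h
    refine ⟨(M.comap N₀'.mkQ).map N₂.subtype, ?_, ?_, Submodule.map_subtype_le _ _, ?_, ?_⟩
    · rintro α _ ⟨x, hx, rfl⟩
      refine ⟨σ.op α x, ?_, hσ α x⟩
      have := hM α _ hx
      rwa [hτ] at this
    · intro x hx
      refine ⟨⟨x, h12 (h01 hx)⟩, ?_, rfl⟩
      have : N₀'.mkQ ⟨x, h12 (h01 hx)⟩ = 0 := (mk0 _).mpr hx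
      change N₀'.mkQ _ ∈ M
      rw [this]
      exact M.zero_mem
    · rintro _ ⟨⟨x, hx, rfl⟩, hx1⟩
      refine (mk0 x).mp ?_
      rw [← Submodule.mem_bot k, ← hinf]
      exact ⟨hx, Submodule.mem_map_of_mem hx1⟩
    · intro x hx
      have : N₀'.mkQ ⟨x, hx⟩ ∈ M ⊔ Y := hsup ▸ Submodule.mem_top
      obtain ⟨n, hn, _, ⟨y, hy, rfl⟩, hny⟩ := Submodule.mem_sup.mp this
      have h1 : (⟨x, hx⟩ : N₂) - y ∈ M.comap N₀'.mkQ := by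
        rw [Submodule.mem_comap, map_sub, ← hny, add_sub_cancel_right]
        exact hn
      have h2 := Submodule.add_mem_sup (Submodule.mem_map_of_mem (f := N₂.subtype) h1)
        (show (y : V) ∈ N₁ from hy)
      simpa using h2

lemma exists_isWF_of_isNegWeightedAlg {O B : Type*} [CommRing O] [HopfAlgebra k O]
    [CommRing B] [HopfAlgebra k B] {V : Type*} [AddCommGroup V] [Module k V] [Module.Finite k V]
    {q : O →ₐc[k] B} {w : O →ₐc[k] k[T;T⁻¹]} (hw : IsCentral w) (hq : IsNegWeightedAlg w q)
    (ρ : GModule k B V) : ∃ F, IsWF ρ q w F := by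
  refine exists_isWF hq.faithfullyFlat.injective
    (hasPureSub_of_descentPart hq.faithfullyFlat.injective hw fun N hN σ => ?_)
    (hasSplitting_of_isNegWeightedAlg hw hq ρ)
  have : Nontrivial (V ⧸ N) := Submodule.Quotient.nontrivial_iff.mpr hN
  exact descentPart_ne_bot hq.faithfullyFlat hq.unipotent σ

variable {O : Type r} [CommRing O] [HopfAlgebra k O] {A : Type g} [CommRing A] [HopfAlgebra k A]
  {w : O →ₐc[k] k[T;T⁻¹]} {p : O →ₐc[k] A}

lemma IsNegWeighted.injective (h : IsNegWeighted w p) : Function.Injective p := by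
  obtain ⟨B, _, _, q, j, hj, rfl, _, hq⟩ := h ∅
  exact hj.comp hq.faithfullyFlat.injective

lemma Compat.comp {B : Type*} [CommRing B] [HopfAlgebra k B] {q : O →ₐc[k] B} {j : B →ₐc[k] A}
    (hjq : j.comp q = p) {α : A →ₗ[k] k} {β : k[T;T⁻¹] →ₗ[k] k} (h : Compat p w α β) :
    Compat q w (α ∘ₗ (j : B →ₗ[k] A)) β := by
  subst hjq
  exact h

/-- The finitely many matrix coefficients in a basis lie in some `O(G_α)`, so the module is
restricted from the algebraic extension `G_α`, and stability and purity pull back along `G → G_α`.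
-/
lemma IsNegWeighted.exists_isWF (h : IsNegWeighted w p) (hw : IsCentral w) {V : Type*}
    [AddCommGroup V] [Module k V] [Module.Finite k V] (ρ : GModule k A V) :
    ∃ F, IsWF ρ p w F := by
  classical
  let e := Module.finBasis k V
  obtain ⟨B, _, _, q, j, hj, hjq, hs, hq⟩ :=
    h (Finset.univ.image fun x : Fin _ × Fin _ => coef ρ (e.coord x.1) (e x.2))
  obtain ⟨ρB, rfl⟩ := ρ.exists_res_eq hj (by
    intro α hα v
    have : ρ.op α = 0 := by
      refine e.ext fun j' => ?_
      refine e.ext_elem fun i => ?_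
      obtain ⟨b, hb⟩ := hs _ (Finset.mem_image_of_mem _ (Finset.mem_univ (i, j')))
      rw [← e.coord_apply, ← apply_coef, ← hb]
      simpa using LinearMap.congr_fun hα b
    rw [this, LinearMap.zero_apply])
  obtain ⟨F, hF⟩ := exists_isWF_of_isNegWeightedAlg hw hq ρB
  refine ⟨F, hF.mono, hF.eq_bot, hF.eq_top, fun m α v hv => ?_, fun m α β hc v hv => ?_⟩
  · rw [ρB.op_res]
    exact hF.stable m _ v hv
  · rw [ρB.op_res]
    exact hF.pure m _ β (hc.comp hjq) v hv

end Existence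

/-! ### Comparison with the definition of a weight filtration -/

section Comparison

variable {k : Type u} [Field k]

lemma mem_weightSpace_iff {A V : Type*} [CommRing A] [HopfAlgebra k A] [AddCommGroup V]
    [Module k V] (ρ : GModule k A V) (χ : A →ₐc[k] k[T;T⁻¹]) (m : ℤ) (v : V) :
    v ∈ ρ.weightSpace χ m ↔
      ∀ β : k[T;T⁻¹] →ₗ[k] k, ρ.op (β ∘ₗ (χ : A →ₗ[k] k[T;T⁻¹])) v = β (T m) • v := by
  have e : v ∈ ρ.weightSpace χ m ↔ (ρ.res χ).coact v = v ⊗ₜ[k] (T m : k[T;T⁻¹]) := Iff.rfl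
  rw [e]
  refine ⟨fun h β => ?_, fun h => ext_slice fun β => ?_⟩
  · rw [← ρ.op_res, GModule.op_apply, h, slice_tmul]
  · rw [slice_tmul, ← GModule.op_apply, ρ.op_res, h]

lemma NegWeightedExt.isCentral (E : NegWeightedExt.{u, r, g} k) : IsCentral E.w := E.central

lemma NegWeightedExt.injective (E : NegWeightedExt.{u, r, g} k) : Function.Injective E.p :=
  E.negWeighted.injective

lemma isWeightFiltration_iff (M : WeightedModule.{u, r, g, v} k) (F : ℤ → Submodule k M.V) :
    IsWeightFiltration M F ↔ IsWF M.rep M.E.p M.E.w F := by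
  constructor
  · intro h
    refine ⟨h.mono, h.eq_bot, h.eq_top, fun m => ?_, fun m => ?_⟩
    · obtain ⟨σ, hσ, -⟩ := h.graded m
      intro α v hv
      rw [isGHom_iff] at hσ
      have := hσ α ⟨v, hv⟩
      rw [Submodule.subtype_apply] at this
      rw [this]
      exact (σ.op α ⟨v, hv⟩).2
    · obtain ⟨σ, hσ, τ, hτ, hwt⟩ := h.graded m
      intro α β hc v hv
      rw [isGHom_iff] at hσ hτ
      have h1 := hσ α ⟨v, hv⟩
      have h2 := hτ α ⟨v, hv⟩
      have h3 : (prev F m).mkQ ⟨v, hv⟩ ∈ τ.weightSpace M.E.w m := hwt ▸ Submodule.mem_top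
      rw [mem_weightSpace_iff] at h3
      rw [τ.op_res, hc, h3, ← map_smul, eq_comm, ← sub_eq_zero, ← map_sub] at h2
      have h4 := (Submodule.Quotient.mk_eq_zero (prev F m)).mp h2
      rw [Submodule.subtype_apply] at h1
      rw [h1]
      exact h4
  · intro h
    refine ⟨h.mono, h.eq_bot, h.eq_top, fun m => ?_⟩
    obtain ⟨σ, hσ⟩ := (h.stable m).exists_sub
    have hprev : IsStable σ (prev F m) := fun α v hv => by
      change ((σ.op α v : F m) : M.V) ∈ F (m - 1)
      rw [hσ]
      exact h.stable (m - 1) α _ hv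
    obtain ⟨ρ', hρ'⟩ := hprev.exists_quot
    have key : ∀ α β, Compat M.E.p M.E.w α β → ∀ x, ρ'.op α x = β (T m) • x := by
      intro α β hc x
      obtain ⟨x, rfl⟩ := (prev F m).mkQ_surjective x
      rw [hρ', ← map_smul, ← sub_eq_zero, ← map_sub]
      refine (Submodule.Quotient.mk_eq_zero (prev F m)).mpr ?_
      change ((σ.op α x - β (T m) • x : F m) : M.V) ∈ F (m - 1)
      rw [Submodule.coe_sub, hσ]
      exact h.pure m α β hc x x.2
    -- The pairs `(α, 0)` say exactly that functionals vanishing on `O(R)` act by zero, which is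
    -- what descent to `R` requires.
    obtain ⟨τ, hτ⟩ := ρ'.exists_res_eq M.E.injective (fun α hα x => by
      have : Compat M.E.p M.E.w α 0 := by rw [Compat, hα, LinearMap.zero_comp]
      rw [key α 0 this, LinearMap.zero_apply, zero_smul])
    refine ⟨σ, (isGHom_iff _ _ _).mpr fun α x => (hσ α x).symm, τ, ?_, ?_⟩
    · rw [hτ]
      exact (isGHom_iff _ _ _).mpr hρ'
    · rw [eq_top_iff]
      intro x _
      rw [mem_weightSpace_iff]
      intro β
      obtain ⟨α, hα⟩ := exists_compat M.E.injective M.E.w β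
      rw [← key α β hα, ← hα, ← τ.op_res, hτ]

/-- The weight filtration of a weighted module. -/
def weightFiltration (M : WeightedModule.{u, r, g, v} k) : ℤ → Submodule k M.V :=
  (M.E.negWeighted.exists_isWF M.E.isCentral M.rep).choose

lemma isWF_weightFiltration (M : WeightedModule.{u, r, g, v} k) :
    IsWF M.rep M.E.p M.E.w (weightFiltration M) :=
  (M.E.negWeighted.exists_isWF M.E.isCentral M.rep).choose_spec

lemma IsWF.eq_weightFiltration {M : WeightedModule.{u, r, g, v} k} {F : ℤ → Submodule k M.V}
    (h : IsWF M.rep M.E.p M.E.w F) : F = weightFiltration M :=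
  h.unique M.E.injective (isWF_weightFiltration M)

lemma isWeightFiltration_iff_eq (M : WeightedModule.{u, r, g, v} k) (F : ℤ → Submodule k M.V) :
    IsWeightFiltration M F ↔ F = weightFiltration M := by
  rw [isWeightFiltration_iff]
  refine ⟨fun h => h.eq_weightFiltration, ?_⟩
  rintro rfl
  exact isWF_weightFiltration M

end Comparison

/-! ### Lifts of the cocharacter -/

section Lift

variable {k : Type u} [Field k]

lemma weightFiltration_eq_iSup (E : NegWeightedExt.{u, r, g} k) {B : Type g} [CommRing B]
    [HopfAlgebra k B] {q : E.OR →ₐc[k] B} {j : B →ₐc[k] E.OG} {wl : B →ₐc[k] k[T;T⁻¹]}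
    {V : Type v} [AddCommGroup V] [Module k V] [Module.Finite k V] (ρ : GModule k B V)
    (hj : Function.Injective j) (hjq : j.comp q = E.p) (hwl : wl.comp q = E.w) (n : ℤ) :
    weightFiltration ⟨E, V, ρ.res j⟩ n = ⨆ m : ℤ, ⨆ _ : m ≤ n, ρ.weightSpace wl m := by
  have h := isWF_weightFiltration (⟨E, V, ρ.res j⟩ : WeightedModule.{u, r, g, v} k)
  set W : ℤ → Submodule k V := weightFiltration ⟨E, V, ρ.res j⟩
  -- Any functional on `B` extends to `O(G)`, so purity can be evaluated on functionals that come
  -- from the lift `wl`.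
  have hpure : ∀ (β : k[T;T⁻¹] →ₗ[k] k) (m : ℤ), ∀ x ∈ W m,
      ρ.op (β ∘ₗ (wl : B →ₗ[k] k[T;T⁻¹])) x - β (T m) • x ∈ W (m - 1) := by
    intro β m x hx
    obtain ⟨α, hα⟩ := exists_dual_extend (f := (j : B →ₗ[k] E.OG)) hj
      (β ∘ₗ (wl : B →ₗ[k] k[T;T⁻¹]))
    have hc : Compat E.p E.w α β := by
      rw [← hjq, ← hwl]
      exact congrArg (fun γ : B →ₗ[k] k => γ ∘ₗ (q : E.OR →ₗ[k] B)) hα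
    rw [← hα, ← ρ.op_res]
    exact h.pure m α β hc x hx
  apply le_antisymm
  · obtain ⟨a, ha⟩ := h.eq_bot
    rcases le_total n a with hna | hna
    · refine (h.mono hna).trans ?_
      rw [ha]
      exact bot_le
    · induction n, hna using Int.leInduction with
      | base =>
        rw [ha]
        exact bot_le
      | succ n hna ih =>
        intro x hx
        -- The projection of `x` to weight `n + 1` under `wl` differs from `x` by an element of `W
        -- n`, to which induction applies.
        have h1 := hpure (coeffT k (n + 1)) _ x hx
        rw [coeffT_T, if_pos rfl, one_smul, add_sub_cancel_right] at h1
        have h2 := ih h1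
        have h3 : ρ.op (coeffT k (n + 1) ∘ₗ (wl : B →ₗ[k] k[T;T⁻¹])) x ∈
            ρ.weightSpace wl (n + 1) := by
          rw [mem_weightSpace_iff]
          intro β
          rw [ρ.op_op, ← conv_comp, conv_coeffT, LinearMap.smul_comp, ρ.op_smul]
        have h4 : ⨆ m : ℤ, ⨆ _ : m ≤ n, ρ.weightSpace wl m ≤
            ⨆ m : ℤ, ⨆ _ : m ≤ n + 1, ρ.weightSpace wl m :=
          iSup_mono fun m => iSup_mono' fun hm => ⟨by omega, le_rfl⟩
        have h5 := Submodule.sub_mem _ (Submodule.mem_iSup_of_mem (n + 1)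
          (Submodule.mem_iSup_of_mem le_rfl h3)) (h4 h2)
        rwa [sub_sub_cancel] at h5
  · refine iSup_le fun m => iSup_le fun hm => le_trans ?_ (h.mono hm)
    intro x hx
    rw [mem_weightSpace_iff] at hx
    obtain ⟨b, hb⟩ := h.eq_top
    -- Above weight `m`, the projection to weight `b - i` kills `x`, but by purity it is the
    -- identity modulo the next lower step.
    have hdown : ∀ i : ℕ, m ≤ b - i → x ∈ W (b - i) := by
      intro i
      induction i with
      | zero =>
        intro _
        rw [Nat.cast_zero, sub_zero, hb]
        exact Submodule.mem_top
      | succ i ih =>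
        intro hi
        push_cast at hi ⊢
        have h1 := hpure (coeffT k (b - i)) _ x (ih (by omega))
        rw [hx, coeffT_T, coeffT_T, if_pos rfl, if_neg (by omega), zero_smul, one_smul,
          zero_sub, Submodule.neg_mem_iff] at h1
        rwa [← sub_sub]
    rcases le_total m b with hmb | hmb
    · have := hdown (b - m).toNat (by rw [Int.toNat_of_nonneg (by omega)]; omega)
      rwa [Int.toNat_of_nonneg (by omega), sub_sub_cancel] at this
    · refine h.mono hmb ?_
      rw [hb]
      exact Submodule.mem_top

end Lift

/-! ### Tensor products and internal Homs -/

section TensorHom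

variable {k : Type u} [Field k] {A O : Type*} [CommRing A] [HopfAlgebra k A]
  [CommRing O] [HopfAlgebra k O] {V V₁ V₂ : Type*} [AddCommGroup V] [Module k V]
  [AddCommGroup V₁] [Module k V₁] [AddCommGroup V₂] [Module k V₂]
  {p : O →ₐc[k] A} {w : O →ₐc[k] k[T;T⁻¹]}

/-- A lift to `V ⊗ O(R)` of the coaction modulo `N'`, obtained from a retraction of `p`. It lets
products of coefficients be computed in `O(R)`, where `α` and `β` agree. -/
lemma IsPure.exists_lift (hp : Function.Injective p) {ρ : GModule k A V} {m : ℤ}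
    {N' N : Submodule k V} (h : IsPure ρ p w m N' N) (hN : IsStable ρ N) {v : V} (hv : v ∈ N) :
    ∃ z : V ⊗[k] O, (∀ γ, slice V γ z ∈ N) ∧
      (∀ α, slice V α (ρ.coact v - (p : O →ₗ[k] A).lTensor V z) ∈ N') ∧
      (∀ β, slice V β ((w : O →ₗ[k] k[T;T⁻¹]).lTensor V z - v ⊗ₜ T m) ∈ N') := by
  obtain ⟨s, hs⟩ := (p : O →ₗ[k] A).exists_leftInverse_of_injective (LinearMap.ker_eq_bot.mpr hp)
  refine ⟨s.lTensor V (ρ.coact v), fun γ => ?_, fun α => ?_, fun β => ?_⟩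
  · rw [slice_lTensor]
    exact hN _ v hv
  · have hc : Compat p w (α - α ∘ₗ (p : O →ₗ[k] A) ∘ₗ s) 0 := by
      rw [Compat, LinearMap.sub_comp, LinearMap.comp_assoc, LinearMap.comp_assoc, hs,
        LinearMap.comp_id, sub_self, LinearMap.zero_comp]
    have := h _ _ hc v hv
    rw [LinearMap.zero_apply, zero_smul, sub_zero, ρ.op_sub] at this
    rwa [map_sub, slice_lTensor, slice_lTensor]
  · have hc : Compat p w (β ∘ₗ (w : O →ₗ[k] k[T;T⁻¹]) ∘ₗ s) β := by
      rw [Compat, LinearMap.comp_assoc, LinearMap.comp_assoc, hs, LinearMap.comp_id]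
    have := h _ _ hc v hv
    rwa [map_sub, slice_lTensor, slice_lTensor, slice_tmul]

lemma slice_mulTensor_mem {C : Type*} [CommRing C] [Algebra k C] {N₁ : Submodule k V₁}
    {N₂ : Submodule k V₂} {x : V₁ ⊗[k] C} {y : V₂ ⊗[k] C}
    (hx : ∀ α : C →ₗ[k] k, slice V₁ α x ∈ N₁) (hy : ∀ α : C →ₗ[k] k, slice V₂ α y ∈ N₂)
    (α : C →ₗ[k] k) :
    slice (V₁ ⊗[k] V₂) α (mulTensor k V₁ V₂ C (x ⊗ₜ y)) ∈
      Submodule.map₂ (TensorProduct.mk k V₁ V₂) N₁ N₂ := by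
  obtain ⟨x, rfl⟩ := mem_range_rTensor.mpr hx
  obtain ⟨y, rfl⟩ := mem_range_rTensor.mpr hy
  clear hx hy
  induction x with
  | zero => simp
  | add x x' hx hx' =>
    simp only [map_add, TensorProduct.add_tmul]
    exact Submodule.add_mem _ hx hx'
  | tmul n c =>
    induction y with
    | zero => simp
    | add y y' hy hy' =>
      simp only [map_add, TensorProduct.tmul_add]
      exact Submodule.add_mem _ hy hy'
    | tmul n' c' =>
      simp only [LinearMap.rTensor_tmul, mulTensor_tmul, slice_tmul]
      exact Submodule.smul_mem _ _ (Submodule.apply_mem_map₂ _ n.2 n'.2)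

/-- The tensor product of two filtrations. -/
def tensorFiltration (F₁ : ℤ → Submodule k V₁) (F₂ : ℤ → Submodule k V₂) (n : ℤ) :
    Submodule k (V₁ ⊗[k] V₂) :=
  ⨆ a : ℤ, ⨆ b : ℤ, ⨆ _ : a + b = n, Submodule.map₂ (TensorProduct.mk k V₁ V₂) (F₁ a) (F₂ b)

lemma map₂_le_tensorFiltration (F₁ : ℤ → Submodule k V₁) (F₂ : ℤ → Submodule k V₂) {a b n : ℤ}
    (h : a + b = n) : Submodule.map₂ (TensorProduct.mk k V₁ V₂) (F₁ a) (F₂ b) ≤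
      tensorFiltration F₁ F₂ n :=
  le_iSup_of_le a (le_iSup_of_le b (le_iSup_of_le h le_rfl))

lemma tensorFiltration_le {F₁ : ℤ → Submodule k V₁} {F₂ : ℤ → Submodule k V₂} {n : ℤ}
    {N : Submodule k (V₁ ⊗[k] V₂)}
    (h : ∀ a b, a + b = n → ∀ x ∈ F₁ a, ∀ y ∈ F₂ b, x ⊗ₜ[k] y ∈ N) :
    tensorFiltration F₁ F₂ n ≤ N :=
  iSup_le fun a => iSup_le fun b => iSup_le fun hab => Submodule.map₂_le.mpr (h a b hab)

lemma IsWF.tensor (hp : Function.Injective p) {ρ : GModule k A V₁} {σ : GModule k A V₂}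
    {F₁ : ℤ → Submodule k V₁} {F₂ : ℤ → Submodule k V₂} (h₁ : IsWF ρ p w F₁)
    (h₂ : IsWF σ p w F₂) : IsWF (ρ.tensor σ) p w (tensorFiltration F₁ F₂) := by
  have hop : ∀ α x y, (ρ.tensor σ).op α (x ⊗ₜ[k] y) =
      slice _ α (mulTensor k V₁ V₂ A (ρ.coact x ⊗ₜ σ.coact y)) := fun α x y => rfl
  refine ⟨fun n m hnm => ?_, ?_, ?_, fun n α => ?_, fun n α β hc => ?_⟩
  · refine tensorFiltration_le fun a b hab x hx y hy => ?_
    -- The whole increase of the index is put on the first factor.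
    refine map₂_le_tensorFiltration F₁ F₂ (a := a + (m - n)) (b := b) (by omega) ?_
    exact Submodule.apply_mem_map₂ _ (h₁.mono (by omega) hx) hy
  · obtain ⟨a₀, ha₀⟩ := h₁.eq_bot
    obtain ⟨b₀, hb₀⟩ := h₂.eq_bot
    refine ⟨a₀ + b₀, eq_bot_iff.mpr (tensorFiltration_le fun a b hab x hx y hy => ?_)⟩
    rcases le_or_gt a a₀ with h | h
    · have := h₁.mono h hx
      rw [ha₀, Submodule.mem_bot] at this
      rw [this, TensorProduct.zero_tmul]
      exact Submodule.zero_mem _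
    · have := h₂.mono (show b ≤ b₀ by omega) hy
      rw [hb₀, Submodule.mem_bot] at this
      rw [this, TensorProduct.tmul_zero]
      exact Submodule.zero_mem _
  · obtain ⟨a, ha⟩ := h₁.eq_top
    obtain ⟨b, hb⟩ := h₂.eq_top
    refine ⟨a + b, top_le_iff.mp ?_⟩
    refine le_trans ?_ (map₂_le_tensorFiltration F₁ F₂ rfl)
    rw [ha, hb, TensorProduct.map₂_mk_top_top_eq_top]
  · refine tensorFiltration_le (N := (tensorFiltration F₁ F₂ n).comap ((ρ.tensor σ).op α))
      fun a b hab x hx y hy => ?_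
    rw [Submodule.mem_comap, hop]
    exact map₂_le_tensorFiltration F₁ F₂ hab
      (slice_mulTensor_mem (fun γ => h₁.stable a γ x hx) (fun γ => h₂.stable b γ y hy) α)
  · refine tensorFiltration_le (N := (tensorFiltration F₁ F₂ (n - 1)).comap
      ((ρ.tensor σ).op α - β (T n) • LinearMap.id)) fun a b hab x hx y hy => ?_
    rw [Submodule.mem_comap, LinearMap.sub_apply, hop, LinearMap.smul_apply, LinearMap.id_apply]
    obtain ⟨z, hz1, hz2, hz3⟩ := (h₁.pure a).exists_lift hp (h₁.stable a) hx
    obtain ⟨z', hz1', hz2', hz3'⟩ := (h₂.pure b).exists_lift hp (h₂.stable b) hy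
    set P₁ := (p : O →ₗ[k] A).lTensor V₁ z with hP₁
    set P₂ := (p : O →ₗ[k] A).lTensor V₂ z' with hP₂
    set Q₁ := (w : O →ₗ[k] k[T;T⁻¹]).lTensor V₁ z with hQ₁
    set Q₂ := (w : O →ₗ[k] k[T;T⁻¹]).lTensor V₂ z' with hQ₂
    -- The main terms are both images of the product of the lifts over `O(R)`, where `α` and `β`
    -- have the same pullback. The corrections in `d1` and `d2` each lower the degree of one factor
    -- by at least one.
    have hmain : slice _ α (mulTensor k V₁ V₂ A (P₁ ⊗ₜ P₂)) =
        slice _ β (mulTensor k V₁ V₂ k[T;T⁻¹] (Q₁ ⊗ₜ Q₂)) := by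
      have e1 := mulTensor_natural (p : O →ₐ[k] A) z z'
      have e2 := mulTensor_natural (w : O →ₐ[k] k[T;T⁻¹]) z z'
      refine (congrArg (slice _ α) e1.symm).trans
        (Eq.trans ?_ (congrArg (slice _ β) e2))
      rw [slice_lTensor, slice_lTensor]
      exact congrArg (fun γ => slice _ γ _) hc
    have d1 : slice _ α (mulTensor k V₁ V₂ A (ρ.coact x ⊗ₜ σ.coact y)) =
        slice _ α (mulTensor k V₁ V₂ A (P₁ ⊗ₜ P₂)) +
        slice _ α (mulTensor k V₁ V₂ A ((ρ.coact x - P₁) ⊗ₜ σ.coact y)) +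
        slice _ α (mulTensor k V₁ V₂ A (P₁ ⊗ₜ (σ.coact y - P₂))) := by
      simp only [TensorProduct.sub_tmul, TensorProduct.tmul_sub, map_sub]
      abel
    have d2 : slice _ β (mulTensor k V₁ V₂ k[T;T⁻¹] (Q₁ ⊗ₜ Q₂)) =
        β (T n) • (x ⊗ₜ y) +
        slice _ β (mulTensor k V₁ V₂ k[T;T⁻¹] ((Q₁ - x ⊗ₜ T a) ⊗ₜ Q₂)) +
        slice _ β (mulTensor k V₁ V₂ k[T;T⁻¹] ((x ⊗ₜ T a) ⊗ₜ (Q₂ - y ⊗ₜ T b))) := by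
      simp only [TensorProduct.sub_tmul, TensorProduct.tmul_sub, map_sub, mulTensor_tmul,
        slice_tmul, ← T_add, hab]
      abel
    have mleft : ∀ t ∈ Submodule.map₂ (TensorProduct.mk k V₁ V₂) (F₁ (a - 1)) (F₂ b),
        t ∈ tensorFiltration F₁ F₂ (n - 1) := fun t ht =>
      map₂_le_tensorFiltration F₁ F₂ (by omega) ht
    have mright : ∀ t ∈ Submodule.map₂ (TensorProduct.mk k V₁ V₂) (F₁ a) (F₂ (b - 1)),
        t ∈ tensorFiltration F₁ F₂ (n - 1) := fun t ht =>
      map₂_le_tensorFiltration F₁ F₂ (by omega) ht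
    rw [d1, hmain, d2, add_assoc, add_assoc, add_assoc, add_sub_cancel_left]
    refine Submodule.add_mem _ (mleft _ (slice_mulTensor_mem hz3 (fun γ => ?_) β))
      (Submodule.add_mem _ (mright _ (slice_mulTensor_mem (fun γ => ?_) hz3' β))
      (Submodule.add_mem _ (mleft _ (slice_mulTensor_mem hz2 (fun γ => ?_) α))
        (mright _ (slice_mulTensor_mem (fun γ => ?_) hz2' α))))
    · rw [hQ₂, slice_lTensor]
      exact hz1' _
    · rw [slice_tmul]
      exact Submodule.smul_mem _ _ hx
    · exact h₂.stable b γ y hy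
    · rw [hP₁, slice_lTensor]
      exact hz1 _

/-- The filtration of `Hom(V₁, V₂)` by the maps that raise degrees by at most `n`. -/
def homFiltration (F₁ : ℤ → Submodule k V₁) (F₂ : ℤ → Submodule k V₂) (n : ℤ) :
    Submodule k (V₁ →ₗ[k] V₂) where
  carrier := {φ | ∀ a, ∀ x ∈ F₁ a, φ x ∈ F₂ (a + n)}
  add_mem' hφ hψ a x hx := Submodule.add_mem _ (hφ a x hx) (hψ a x hx)
  zero_mem' _ _ _ := Submodule.zero_mem _
  smul_mem' c _ hφ a x hx := Submodule.smul_mem _ c (hφ a x hx)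

lemma slice_mulRight {C : Type*} [CommRing C] [Algebra k C] (α : C →ₗ[k] k) (t : V ⊗[k] C)
    (c : C) : slice V α (mulRight k V C (t ⊗ₜ c)) = slice V (α ∘ₗ LinearMap.mulRight k c) t := by
  induction t with
  | zero => simp
  | add x y hx hy => simp only [TensorProduct.add_tmul, map_add, hx, hy]
  | tmul v a => simp

lemma hom_op_apply [Module.Finite k V₁] (ρ : GModule k A V₁) (σ : GModule k A V₂)
    (α : A →ₗ[k] k) (φ : V₁ →ₗ[k] V₂) (u : V₁) :
    (ρ.hom σ).op α φ u = slice V₂ α (conjMap ρ σ φ u) := by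
  have h1 : ∀ z : (V₁ →ₗ[k] V₂) ⊗[k] A, slice _ α z u =
      slice V₂ α (rTensorHomEquivHomRTensor k V₁ V₂ A z u) := by
    intro z
    rw [rTensorHomEquivHomRTensor_apply]
    induction z with
    | zero => simp
    | add x y hx hy => simp only [map_add, LinearMap.add_apply, hx, hy]
    | tmul v a => simp
  rw [GModule.op_apply, h1]
  simp only [GModule.hom, LinearMap.comp_apply, LinearEquiv.coe_coe, LinearEquiv.apply_symm_apply]

lemma conjMap_apply (ρ : GModule k A V₁) (σ : GModule k A V₂) (φ : V₁ →ₗ[k] V₂) (u : V₁) :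
    conjMap ρ σ φ u = mulRight k V₂ A
      (TensorProduct.map (σ.coact ∘ₗ φ) (antipode k (A := A)) (ρ.coact u)) := rfl

lemma slice_mulRight_map_mem {σ : GModule k A V₂} {φ : V₁ →ₗ[k] V₂} {N₁ : Submodule k V₁}
    {N₂ : Submodule k V₂} (hN : IsStable σ N₂) (hφ : ∀ x ∈ N₁, φ x ∈ N₂) {y : V₁ ⊗[k] A}
    (hy : ∀ α : A →ₗ[k] k, slice V₁ α y ∈ N₁) (α : A →ₗ[k] k) :
    slice V₂ α (mulRight k V₂ A
      (TensorProduct.map (σ.coact ∘ₗ φ) (antipode k (A := A)) y)) ∈ N₂ := by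
  obtain ⟨y, rfl⟩ := mem_range_rTensor.mpr hy
  clear hy
  induction y with
  | zero => simp
  | add x y hx hy =>
    simp only [map_add]
    exact Submodule.add_mem _ hx hy
  | tmul n c =>
    rw [LinearMap.rTensor_tmul, TensorProduct.map_tmul, slice_mulRight]
    exact hN _ _ (hφ _ n.2)

/-- For maps, `x ∘ φ ∘ x⁻¹` on a vector of weight `a` multiplies weight `a + n` by the inverse of
weight `a`, leaving `n`. Errors in the source lower degree by `hφ`, and errors in the target by
purity of `F₂`. -/
lemma IsWF.hom [Module.Finite k V₁] (hp : Function.Injective p) {ρ : GModule k A V₁}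
    {σ : GModule k A V₂} {F₁ : ℤ → Submodule k V₁} {F₂ : ℤ → Submodule k V₂}
    (h₁ : IsWF ρ p w F₁) (h₂ : IsWF σ p w F₂) : IsWF (ρ.hom σ) p w (homFiltration F₁ F₂) := by
  obtain ⟨a₁, ha₁⟩ := h₁.eq_bot
  obtain ⟨b₁, hb₁⟩ := h₁.eq_top
  obtain ⟨a₂, ha₂⟩ := h₂.eq_bot
  obtain ⟨b₂, hb₂⟩ := h₂.eq_top
  refine ⟨fun n m hnm φ hφ a x hx => h₂.mono (by omega) (hφ a x hx), ⟨a₂ - b₁, ?_⟩,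
    ⟨b₂ - a₁, ?_⟩, fun n α φ hφ a x hx => ?_, fun n α β hc φ hφ a x hx => ?_⟩
  · rw [eq_bot_iff]
    intro φ hφ
    rw [Submodule.mem_bot]
    ext x
    have := hφ b₁ x (hb₁ ▸ Submodule.mem_top)
    rwa [add_sub_cancel, ha₂, Submodule.mem_bot] at this
  · rw [eq_top_iff]
    intro φ _ a x hx
    rcases le_total a a₁ with h | h
    · have := h₁.mono h hx
      rw [ha₁, Submodule.mem_bot] at this
      rw [this, map_zero]
      exact Submodule.zero_mem _
    · refine h₂.mono (show b₂ ≤ _ by omega) ?_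
      rw [hb₂]
      exact Submodule.mem_top
  · rw [hom_op_apply, conjMap_apply]
    exact slice_mulRight_map_mem (h₂.stable _) (hφ a) (fun γ => h₁.stable a γ x hx) α
  · rw [LinearMap.sub_apply, hom_op_apply, conjMap_apply, LinearMap.smul_apply]
    obtain ⟨z, hz1, hz2, hz3⟩ := (h₁.pure a).exists_lift hp (h₁.stable a) hx
    have hφ' : ∀ y ∈ F₁ (a - 1), φ y ∈ F₂ (a + (n - 1)) := fun y hy => by
      have := hφ _ y hy
      rwa [show a - 1 + n = a + (n - 1) by ring] at this
    have e1 := slice_mulRight_map_mem (h₂.stable _) hφ' hz2 α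
    rw [map_sub, map_sub, map_sub] at e1
    -- Chosen so that `β' (T a) = β (T n)`: it absorbs the weight `a + n` of `φ x` and the inversion
    -- on the source.
    let β' : k[T;T⁻¹] →ₗ[k] k :=
      β ∘ₗ LinearMap.mulLeft k (T (a + n)) ∘ₗ antipode k (A := k[T;T⁻¹])
    have e2 := hφ' _ (hz3 β')
    rw [map_sub, slice_tmul, map_sub, map_smul] at e2
    have hβ' : β' (T a) = β (T n) := by
      simp only [β', LinearMap.comp_apply, antipode_T, LinearMap.mulLeft_apply, ← T_add]
      congr 2
      ring
    rw [hβ'] at e2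
    have e3 : slice V₂ α (mulRight k V₂ A (TensorProduct.map (σ.coact ∘ₗ φ) (antipode k (A := A))
        ((p : O →ₗ[k] A).lTensor V₁ z))) -
        φ (slice V₁ β' ((w : O →ₗ[k] k[T;T⁻¹]).lTensor V₁ z)) ∈ F₂ (a + (n - 1)) := by
      obtain ⟨z, rfl⟩ := mem_range_rTensor.mpr hz1
      clear hz1 hz2 hz3 e1 e2
      induction z with
      | zero => simp
      | add x y hx hy =>
        simp only [map_add, add_sub_add_comm]
        exact Submodule.add_mem _ hx hy
      | tmul u o =>
        -- Right multiplication by the antipode of `o ∈ O(R)` keeps the pair compatible, so purity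
        -- of `F₂` applies to `φ u`.
        have hc' : Compat p w (α ∘ₗ LinearMap.mulRight k (p (antipode k o)))
            (β ∘ₗ LinearMap.mulRight k (w (antipode k o))) := by
          ext o'
          change α (p o' * p (antipode k o)) = β (w o' * w (antipode k o))
          rw [← map_mul, ← map_mul, hc.apply]
        have h3 := h₂.pure (a + n) _ _ hc' _ (hφ a u u.2)
        rw [LinearMap.rTensor_tmul, LinearMap.lTensor_tmul, LinearMap.lTensor_tmul,
          TensorProduct.map_tmul, slice_mulRight, slice_tmul, map_smul]
        have h4 : antipode k ((p : O →ₗ[k] A) o) = p (antipode k o) := antipode_bialgHom p o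
        have h5 : β' ((w : O →ₗ[k] k[T;T⁻¹]) o) =
            (β ∘ₗ LinearMap.mulRight k (w (antipode k o))) (T (a + n)) :=
          congrArg (fun y => β (T (a + n) * y)) (antipode_bialgHom w o)
        rw [h4, h5, ← add_sub_assoc]
        exact h3
    have := Submodule.add_mem _ (Submodule.add_mem _ e1 e3) e2
    simpa using this

end TensorHom

/-! ### Strictness and exactness -/

section Strictness

variable {k : Type u} [Field k]

/-- On the range of `l`, the image filtration `K` and the induced filtration `L` are pure over the
source group. Both begin at zero and exhaust the range, so `le_of_pure` in both directions
identifies them. -/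
lemma isStrict_linearMap {M N : WeightedModule.{u, r, g, v} k} (f : M ⟶ N) :
    IsStrict (weightFiltration M) (weightFiltration N) (WeightedModule.linearMap f) := by
  let Φ : N.E.OG →ₐc[k] M.E.OG := WeightedModule.Hom.Φ f
  let φ : N.E.OR →ₐc[k] M.E.OR := WeightedModule.Hom.φ f
  have hΦ : Φ.comp N.E.p = M.E.p.comp φ := WeightedModule.Hom.comm_p f
  have hφ : M.E.w.comp φ = N.E.w := WeightedModule.Hom.comm_w f
  set l : M.V →ₗ[k] N.V := WeightedModule.linearMap f
  have hl : ∀ α v, (N.rep.res Φ).op α (l v) = l (M.rep.op α v) :=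
    (isGHom_iff _ _ _).mp (WeightedModule.Hom.equivariant f)
  have hM := isWF_weightFiltration M
  have hN := isWF_weightFiltration N
  have hc : ∀ α β, Compat M.E.p M.E.w α β →
      Compat N.E.p N.E.w (α ∘ₗ (Φ : N.E.OG →ₗ[k] M.E.OG)) β := by
    intro α β h
    ext o
    have h1 : Φ (N.E.p o) = M.E.p (φ o) := DFunLike.congr_fun hΦ o
    have h2 : M.E.w (φ o) = N.E.w o := DFunLike.congr_fun hφ o
    change α (Φ (N.E.p o)) = β (N.E.w o)
    rw [h1, ← h2, h.apply]
  have hrange : IsStable (N.rep.res Φ) (LinearMap.range l) := by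
    rintro α _ ⟨x, rfl⟩
    exact ⟨_, (hl α x).symm⟩
  let K : ℤ → Submodule k N.V := fun m => (weightFiltration M m).map l
  let L : ℤ → Submodule k N.V := fun m => weightFiltration N m ⊓ LinearMap.range l
  have hK : ∀ m, IsPure (N.rep.res Φ) M.E.p M.E.w m (K (m - 1)) (K m) := by
    rintro m α β h _ ⟨x, hx, rfl⟩
    rw [hl, ← map_smul, ← map_sub]
    exact Submodule.mem_map_of_mem (hM.pure m α β h x hx)
  have hL : ∀ m, IsPure (N.rep.res Φ) M.E.p M.E.w m (L (m - 1)) (L m) := by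
    intro m
    refine IsPure.inf_right (fun α β h x hx => ?_) hrange
    rw [N.rep.op_res]
    exact hN.pure m _ β (hc α β h) x hx
  have hKm : Monotone K := fun m n hmn => Submodule.map_mono (hM.mono hmn)
  have hLm : Monotone L := fun m n hmn => inf_le_inf_right _ (hN.mono hmn)
  have hKL : ∀ n, K n = L n := by
    obtain ⟨a, ha⟩ := hM.eq_bot
    obtain ⟨b, hb⟩ := hM.eq_top
    obtain ⟨a', ha'⟩ := hN.eq_bot
    obtain ⟨b', hb'⟩ := hN.eq_top
    intro n
    refine le_antisymm
      (le_of_pure M.E.injective hKm hLm ⟨a, by simp [K, ha]⟩ ⟨b', fun n => ?_⟩ hK hL n)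
      (le_of_pure M.E.injective hLm hKm ⟨a', by simp [L, ha']⟩ ⟨b, fun n => ?_⟩ hL hK n)
    · simp only [K, L, hb', top_inf_eq]
      exact LinearMap.map_le_range
    · simp only [K, L, hb, Submodule.map_top]
      exact inf_le_right
  refine ⟨fun m x hx => ?_, fun m => ?_⟩
  · exact ((hKL m).le (Submodule.mem_map_of_mem hx)).1
  · rw [inf_comm]
    exact (hKL m).symm

variable {V₁ V₂ V₃ : Type*} [AddCommGroup V₁] [Module k V₁] [AddCommGroup V₂] [Module k V₂]
  [AddCommGroup V₃] [Module k V₃] {F₁ : ℤ → Submodule k V₁} {F₂ : ℤ → Submodule k V₂}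
  {F₃ : ℤ → Submodule k V₃} {a : V₁ →ₗ[k] V₂} {b : V₂ →ₗ[k] V₃}

lemma IsStrict.mem_of_apply_mem (h : IsStrict F₁ F₂ a) (ha : Function.Injective a) {m : ℤ}
    {x : V₁} (hx : a x ∈ F₂ m) : x ∈ F₁ m := by
  have : a x ∈ (F₁ m).map a := (h.2 m).le ⟨⟨x, rfl⟩, hx⟩
  obtain ⟨y, hy, hxy⟩ := this
  exact ha hxy ▸ hy

lemma IsStrict.exists_of_surjective (h : IsStrict F₂ F₃ b) (hb : Function.Surjective b) {m : ℤ}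
    {y : V₃} (hy : y ∈ F₃ m) : ∃ x ∈ F₂ m, b x = y :=
  (h.2 m).le ⟨hb y, hy⟩

lemma ShortExact.mapW (h : ShortExact a b) (hsa : IsStrict F₁ F₂ a) (hsb : IsStrict F₂ F₃ b)
    (ha : Preserves F₁ F₂ a) (hb : Preserves F₂ F₃ b) (m : ℤ) :
    ShortExact (mapW ha m) (mapW hb m) := by
  obtain ⟨hinj, hex, hsurj⟩ := h
  refine ⟨fun x y hxy => ?_, fun x => ⟨fun hx => ?_, ?_⟩, fun y => ?_⟩
  · exact Subtype.ext (hinj (congrArg Subtype.val hxy))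
  · obtain ⟨z, hz⟩ := (hex x).mp (congrArg Subtype.val hx)
    exact ⟨⟨z, hsa.mem_of_apply_mem hinj (hz ▸ x.2)⟩, Subtype.ext hz⟩
  · rintro ⟨z, rfl⟩
    exact Subtype.ext ((hex _).mpr ⟨z, rfl⟩)
  · obtain ⟨x, hx, hxy⟩ := hsb.exists_of_surjective hsurj y.2
    exact ⟨⟨x, hx⟩, Subtype.ext hxy⟩

lemma ShortExact.mapGr (h : ShortExact a b) (hsa : IsStrict F₁ F₂ a) (hsb : IsStrict F₂ F₃ b)
    (hF₂ : Monotone F₂) (ha : Preserves F₁ F₂ a) (hb : Preserves F₂ F₃ b) (m : ℤ) :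
    ShortExact (mapGr ha m) (mapGr hb m) := by
  have hW := h.mapW hsa hsb ha hb m
  obtain ⟨hinj, hex, hsurj⟩ := h
  refine ⟨?_, fun x => ⟨fun hx => ?_, ?_⟩, fun y => ?_⟩
  · rw [injective_iff_map_eq_zero]
    intro x hx
    obtain ⟨x, rfl⟩ := (prev F₁ m).mkQ_surjective x
    have hx' := (Submodule.Quotient.mk_eq_zero (prev F₂ m)).mp hx
    exact (Submodule.Quotient.mk_eq_zero (prev F₁ m)).mpr (hsa.mem_of_apply_mem hinj hx')
  · obtain ⟨x, rfl⟩ := (prev F₂ m).mkQ_surjective x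
    have hx' : b x ∈ F₃ (m - 1) := (Submodule.Quotient.mk_eq_zero (prev F₃ m)).mp hx
    -- By strictness `b x` lifts to `y` of degree `m - 1`; subtracting it puts `x` in the kernel of
    -- `b` without changing its class in `Gr`.
    obtain ⟨y, hy, hyx⟩ := hsb.exists_of_surjective hsurj hx'
    let y' : F₂ m := ⟨y, hF₂ (by omega) hy⟩
    obtain ⟨z, hz⟩ := (hW.2.1 (x - y')).mp (Subtype.ext (by
      change b ((x : V₂) - y) = 0
      rw [map_sub, hyx, sub_self]))
    refine ⟨(prev F₁ m).mkQ z, ?_⟩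
    change (prev F₂ m).mkQ (NegWt.mapW ha m z) = _
    rw [hz, map_sub, sub_eq_self]
    exact (Submodule.Quotient.mk_eq_zero (prev F₂ m)).mpr hy
  · rintro ⟨z, rfl⟩
    obtain ⟨z, rfl⟩ := (prev F₁ m).mkQ_surjective z
    change (prev F₃ m).mkQ (NegWt.mapW hb m (NegWt.mapW ha m z)) = 0
    rw [(hW.2.1 _).mpr ⟨z, rfl⟩, map_zero]
  · obtain ⟨y, rfl⟩ := (prev F₃ m).mkQ_surjective y
    obtain ⟨x, rfl⟩ := hW.2.2 y
    exact ⟨(prev F₂ m).mkQ x, rfl⟩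

lemma ShortExact.mapQuot (h : ShortExact a b) (hsa : IsStrict F₁ F₂ a) (hsb : IsStrict F₂ F₃ b)
    (ha : Preserves F₁ F₂ a) (hb : Preserves F₂ F₃ b) (m : ℤ) :
    ShortExact (mapQuot ha m) (mapQuot hb m) := by
  obtain ⟨hinj, hex, hsurj⟩ := h
  refine ⟨?_, fun x => ⟨fun hx => ?_, ?_⟩, fun y => ?_⟩
  · rw [injective_iff_map_eq_zero]
    intro x hx
    obtain ⟨x, rfl⟩ := (F₁ m).mkQ_surjective x
    have hx' := (Submodule.Quotient.mk_eq_zero (F₂ m)).mp hx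
    exact (Submodule.Quotient.mk_eq_zero (F₁ m)).mpr (hsa.mem_of_apply_mem hinj hx')
  · obtain ⟨x, rfl⟩ := (F₂ m).mkQ_surjective x
    have hx' : b x ∈ F₃ m := (Submodule.Quotient.mk_eq_zero (F₃ m)).mp hx
    obtain ⟨y, hy, hyx⟩ := hsb.exists_of_surjective hsurj hx'
    obtain ⟨z, hz⟩ := (hex (x - y)).mp (by rw [map_sub, hyx, sub_self])
    refine ⟨(F₁ m).mkQ z, ?_⟩
    change (F₂ m).mkQ (a z) = _
    rw [hz, map_sub, sub_eq_self]
    exact (Submodule.Quotient.mk_eq_zero (F₂ m)).mpr hy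
  · rintro ⟨z, rfl⟩
    obtain ⟨z, rfl⟩ := (F₁ m).mkQ_surjective z
    change (F₃ m).mkQ (b (a z)) = 0
    rw [(hex _).mpr ⟨z, rfl⟩, map_zero]
  · obtain ⟨y, rfl⟩ := (F₃ m).mkQ_surjective y
    obtain ⟨x, rfl⟩ := hsurj y
    exact ⟨(F₂ m).mkQ x, rfl⟩

end Strictness

end NegWt

end

/-! ### Assembly of the theorem -/

theorem mainTheorem12 (k : Type u) [Field k] [CharZero k] :
    ∃ W : ∀ M : NegWt.WeightedModule.{u, r, g, v} k, ℤ → Submodule k M.V,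
      -- `W M` is a weight filtration of `M`, and the only one
      (∀ (M : NegWt.WeightedModule.{u, r, g, v} k) (F : ℤ → Submodule k M.V),
        NegWt.IsWeightFiltration M F ↔ F = W M) ∧
      -- if `V` is a module over a quotient `H` of `G` over `R` (with coordinate ring `B`), and
      -- `wl : 𝔾ₘ → H` is any lift of `w`, then `W_n` is the sum of the weight spaces of `wl`
      -- of weight at most `n`
      (∀ (E : NegWt.NegWeightedExt.{u, r, g} k)
        (B : Type g) [CommRing B] [HopfAlgebra k B]
        (q : E.OR →ₐc[k] B) (j : B →ₐc[k] E.OG) (wl : B →ₐc[k] k[T;T⁻¹])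
        (V : Type v) [AddCommGroup V] [Module k V] [Module.Finite k V] (ρ : NegWt.GModule k B V),
        Function.Injective j → j.comp q = E.p → wl.comp q = E.w →
        ∀ n : ℤ, W ⟨E, V, ρ.res j⟩ n = ⨆ m : ℤ, ⨆ _ : m ≤ n, ρ.weightSpace wl m) ∧
      -- compatibility with tensor products and internal Homs
      (∀ (E : NegWt.NegWeightedExt.{u, r, g} k)
        (V₁ V₂ : Type v) [AddCommGroup V₁] [Module k V₁] [Module.Finite k V₁]
        [AddCommGroup V₂] [Module k V₂] [Module.Finite k V₂]
        (ρ : NegWt.GModule k E.OG V₁) (σ : NegWt.GModule k E.OG V₂) (n : ℤ),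
        (W ⟨E, V₁ ⊗[k] V₂, ρ.tensor σ⟩ n =
          ⨆ a : ℤ, ⨆ b : ℤ, ⨆ _ : a + b = n,
            Submodule.map₂ (TensorProduct.mk k V₁ V₂) (W ⟨E, V₁, ρ⟩ a) (W ⟨E, V₂, σ⟩ b)) ∧
        (∀ φ : V₁ →ₗ[k] V₂, φ ∈ W ⟨E, V₁ →ₗ[k] V₂, ρ.hom σ⟩ n ↔
          ∀ a : ℤ, ∀ x ∈ W ⟨E, V₁, ρ⟩ a, φ x ∈ W ⟨E, V₂, σ⟩ (a + n))) ∧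
      -- morphisms of weighted modules preserve the weight filtration and are strict
      (∀ {M N : NegWt.WeightedModule.{u, r, g, v} k} (f : M ⟶ N),
        NegWt.IsStrict (W M) (W N) (NegWt.WeightedModule.linearMap f)) ∧
      -- the functors `W_m`, `Gr_m` and `V ↦ V / W_m V` are exact
      (∀ {M₁ M₂ M₃ : NegWt.WeightedModule.{u, r, g, v} k} (a : M₁ ⟶ M₂) (b : M₂ ⟶ M₃)
        (ha : NegWt.Preserves (W M₁) (W M₂) (NegWt.WeightedModule.linearMap a))
        (hb : NegWt.Preserves (W M₂) (W M₃) (NegWt.WeightedModule.linearMap b)),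
        NegWt.ShortExact (NegWt.WeightedModule.linearMap a) (NegWt.WeightedModule.linearMap b) →
        ∀ m : ℤ,
          NegWt.ShortExact (NegWt.mapW ha m) (NegWt.mapW hb m) ∧
          NegWt.ShortExact (NegWt.mapGr ha m) (NegWt.mapGr hb m) ∧
          NegWt.ShortExact (NegWt.mapQuot ha m) (NegWt.mapQuot hb m)) := by
  refine ⟨NegWt.weightFiltration, NegWt.isWeightFiltration_iff_eq, ?_, ?_, ?_, ?_⟩
  · intro E B _ _ q j wl V _ _ _ ρ hj hjq hwl n
    exact NegWt.weightFiltration_eq_iSup E ρ hj hjq hwl n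
  · intro E V₁ V₂ _ _ _ _ _ _ ρ σ n
    have h₁ := NegWt.isWF_weightFiltration (⟨E, V₁, ρ⟩ : NegWt.WeightedModule.{u, r, g, v} k)
    have h₂ := NegWt.isWF_weightFiltration (⟨E, V₂, σ⟩ : NegWt.WeightedModule.{u, r, g, v} k)
    constructor
    · rw [← NegWt.IsWF.eq_weightFiltration (M := ⟨E, V₁ ⊗[k] V₂, ρ.tensor σ⟩)
        (h₁.tensor E.injective h₂)]
      rfl
    · intro φ
      rw [← NegWt.IsWF.eq_weightFiltration (M := ⟨E, V₁ →ₗ[k] V₂, ρ.hom σ⟩)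
        (h₁.hom E.injective h₂)]
      rfl
  · intro M N f
    exact NegWt.isStrict_linearMap f
  · intro M₁ M₂ M₃ a b ha hb h m
    have hsa := NegWt.isStrict_linearMap a
    have hsb := NegWt.isStrict_linearMap b
    exact ⟨h.mapW hsa hsb ha hb m,
      h.mapGr hsa hsb (NegWt.isWF_weightFiltration M₂).mono ha hb m,
      h.mapQuot hsa hsb ha hb m⟩
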